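/- Let $\mathcal A$ be a structure with finite domain $A$, $|A|=n$, over a finite signature consisting of relation symbols and possibly constant symbols. A positive Horn sentence is a prenex first-order sentence with quantifiers $\forall,\exists$ whose quantifier-free part is a conjunction of atoms (relational atoms and equalities, with variables and constant symbols as arguments); it is primitive positive if it has no universal quantifier. $\mathrm{QCSP}(\mathcal A)$ is the problem of deciding, for a given positive Horn sentence $\varphi$, whether $\mathcal A\models\varphi$; $\mathrm{CSP}(\mathcal A)$ is the same problem for primitive positive sentences. When every element of $A$ is named by a constant of $\mathcal A$ we write $\mathrm{QCSP}_c(\mathcal A)$, $\mathrm{CSP}_c(\mathcal A)$. A $k$-ary polymorphism of $\mathcal A$ ($k\ge 1$) is a homomorphism $\mathcal A^k\to\mathcal A$ (which preserves relations and constants). An adversary of length $m\ge1$ is a subset of $A^m$. Let $\mathbf\Omega=(\Omega_m)_{m\ge1}$, where $\Omega_m$ is a set of adversaries of length $m$, and let $\mathrm{width}(\Omega_m)=\sum_{\mathscr B\in\Omega_m}|\mathscr B|$. Suppose that: 1. (non-degenerate) for every $m\ge1$ and all $i\ne j$ in $\{1,\dots,m\}$ there are $\mathscr B\in\Omega_m$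 and $t\in\mathscr B$ with $t_i\neq t_j$ (i.e. in the product, over all $\mathscr B\in\Omega_m$ and $t\in\mathscr B$, of the expansions of $\mathcal A$ by constants $c_1,\dots,c_m$ interpreted as $t_1,\dots,t_m$, these $m$ constants are pairwise distinct); 2. (effective) there are a polynomial $q$ and an algorithm (Turing machine) that, given $m\ge1$ in unary, outputs $\Omega_m$ (listing the tuples of each of its adversaries) in time at most $q(m+\mathrm{width}(\Omega_m))$; 3. (projective) for every $m\ge1$ and every $\mathscr B\in\Omega_{n\cdot m}$ there is $\mathscr D\in\Omega_m$ such that, for every choice of one position in each of the $m$ consecutive blocks of $n$ positions, the projection of $\mathscr B$ onto the chosen $m$ positions is contained in $\mathscr D$; 4. (polynomially bounded) there is a polynomial $p$ with $\mathrm{width}(\Omega_m)\le p(m)$ for all $m\ge1$; 5. (generation) for every $m\ge1$, $\Omega_m$ generates $A^m$: for every $t\in A^m$ there are $k\ge1$, a $k$-ary polymorphism $f$ of $\mathcal A$ and $t_1,\dots,t_k\in\bigcup_{\mathscr B\in\Omega_m}\mathscr B$ with $f(t_1,\dots,t_k)=t$ (coordinatewise). Then: (a) For every expansion $\mathcal A'$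 of $\mathcal A$ by a finite (possibly empty) set of constants such that each element of $A$ that occurs in a tuple of an adversary in some $\Omega_m$, $m\ge1$, is named by at least one constant of $\mathcal A'$, the problem $\mathrm{QCSP}(\mathcal A)$ reduces in polynomial time (by a many-one reduction) to $\mathrm{CSP}(\mathcal A')$. (b) In particular, if every element of $A$ is named by a constant of $\mathcal A$, then $\mathrm{QCSP}_c(\mathcal A)$ reduces in polynomial time to $\mathrm{CSP}_c(\mathcal A)$. -/

import Mathlib

namespace QCSPReduction

/-! ### Positive Horn sentences, QCSP and CSP -/

/-- Quantifiers. -/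
inductive Quantifier where
  | all : Quantifier
  | ex : Quantifier

/-- Arguments of atoms: a variable or a constant symbol. -/
inductive Tm (L : FirstOrder.Language.{0, 0}) (V : Type) where
  | var : V → Tm L V
  | const : L.Constants → Tm L V

/-- Atomic formulas `R(s₁, …, sₖ)` and `s = t`. -/
inductive Atom (L : FirstOrder.Language.{0, 0}) (V : Type) where
  | rel : (k : ℕ) → L.Relations k → (Fin k → Tm L V) → Atom L V
  | eq : Tm L V → Tm L V → Atom L V

/-- A positive Horn sentence in prenex form: a quantifier prefix (outermost quantifier first)
followed by a conjunction of atoms.  Variable `i` is the one bound by the `i`-th quantifier. -/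
structure PHSentence (L : FirstOrder.Language.{0, 0}) where
  quants : List Quantifier
  matrix : List (Atom L (Fin quants.length))

/-- Primitive positive sentences: no universal quantifier. -/
def PPSentence (L : FirstOrder.Language.{0, 0}) : Type :=
  {φ : PHSentence L // ∀ q ∈ φ.quants, q = Quantifier.ex}

section Semantics

variable {L : FirstOrder.Language.{0, 0}} {A : Type} [L.Structure A]

/-- Value of a term under an assignment. -/
def Tm.eval {V : Type} (v : V → A) : Tm L V → A
  | .var x => v x
  | .const c => (c : A)

/-- Truth of an atom under an assignment. -/
def Atom.Holds {V : Type} (v : V → A) : Atom L V → Prop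
  | .rel _ r ts => FirstOrder.Language.Structure.RelMap r (fun i => (ts i).eval v)
  | .eq s t => s.eval v = t.eval v

/-- Truth of a quantifier prefix applied to a predicate on assignments. -/
def PrefixHolds (A : Type) : (qs : List Quantifier) → ((Fin qs.length → A) → Prop) → Prop
  | [], P => P Fin.elim0
  | .all :: qs, P => ∀ a : A, PrefixHolds A qs (fun v => P (Fin.cons a v))
  | .ex :: qs, P => ∃ a : A, PrefixHolds A qs (fun v => P (Fin.cons a v))

end Semantics

/-- `A ⊨ φ`. -/
def PHSentence.Holds {L : FirstOrder.Language.{0, 0}} (φ : PHSentence L) (A : Type) [L.Structure A] : Prop :=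
  PrefixHolds A φ.quants (fun v => ∀ α ∈ φ.matrix, α.Holds v)

/-- The problem `QCSP(A)`, as the set of its yes-instances. -/
def QCSP (L : FirstOrder.Language.{0, 0}) (A : Type) [L.Structure A] : Set (PHSentence L) :=
  {φ | φ.Holds A}

/-- The problem `CSP(A)`, as the set of its yes-instances. -/
def CSP (L : FirstOrder.Language.{0, 0}) (A : Type) [L.Structure A] : Set (PPSentence L) :=
  {φ | φ.1.Holds A}

/-! ### Encoding of sentences as words, and polynomial-time reductions -/

/-- The alphabet over which sentences are written. -/
inductive Sym (L : FirstOrder.Language.{0, 0}) where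
  | quant : Quantifier → Sym L
  | rel : (k : ℕ) → L.Relations k → Sym L
  | eq : Sym L
  | const : L.Constants → Sym L
  | var : Sym L
  | tick : Sym L

section Encoding

variable {L : FirstOrder.Language.{0, 0}}

/-- Variable `i` is written as the symbol `var` followed by `i` in unary; as `i` is smaller than
the number of quantifiers of the sentence, unary indices change lengths only polynomially. -/
def Tm.encode {N : ℕ} : Tm L (Fin N) → List (Sym L)
  | .var i => Sym.var :: List.replicate i Sym.tick
  | .const c => [Sym.const c]

/-- Prefix notation. -/
def Atom.encode {N : ℕ} : Atom L (Fin N) → List (Sym L)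
  | .rel k r ts => Sym.rel k r :: (List.ofFn fun i => (ts i).encode).flatten
  | .eq s t => Sym.eq :: (s.encode ++ t.encode)

/-- The quantifier prefix followed by the atoms. -/
def PHSentence.encode (φ : PHSentence L) : List (Sym L) :=
  φ.quants.map Sym.quant ++ (φ.matrix.map Atom.encode).flatten

/-- The same encoding for primitive positive sentences. -/
def PPSentence.encode (φ : PPSentence L) : List (Sym L) :=
  PHSentence.encode φ.1

end Encoding

/-- Polynomial-time many-one reducibility of the problem `P` to the problem `Q`, for instances
written as words by `ea` and `eb`, by a function computed by a polynomial-time Turing machine. -/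
def PolyTimeReducible {α β αΓ βΓ : Type} (ea : α → List αΓ) (eb : β → List βΓ)
    (P : Set α) (Q : Set β) : Prop :=
  ∃ f : α → β, Nonempty (Turing.TM2ComputableInPolyTime ea eb f) ∧ ∀ x, x ∈ P ↔ f x ∈ Q

/-! ### Powers and polymorphisms -/

/-- The domain of the power `A^k`. -/
abbrev Power (A : Type) (k : ℕ) : Type := Fin k → A

/-- The power `A^k` as a structure: everything is coordinatewise. -/
instance Power.structure (L : FirstOrder.Language.{0, 0}) (A : Type) [L.Structure A] (k : ℕ) :
    L.Structure (Power A k) where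
  funMap g x := fun j => FirstOrder.Language.Structure.funMap g (fun i => x i j)
  RelMap r x := ∀ j, FirstOrder.Language.Structure.RelMap r (fun i => x i j)

/-- `k`-ary polymorphisms: homomorphisms from `A^k` to `A` (they preserve the constants too). -/
abbrev Polymorphism (L : FirstOrder.Language.{0, 0}) (A : Type) [L.Structure A] (k : ℕ) : Type :=
  FirstOrder.Language.Hom L (Power A k) A

/-! ### Adversaries -/

/-- An adversary of length `m`: an `m`-ary relation on the finite set `A`. -/
abbrev Adversary (A : Type) (m : ℕ) : Type := Finset (Fin m → A)

/-- A sequence `(Ω_m)` of sets of adversaries, `Ω_m` having adversaries of length `m`.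
Only the members with `m ≥ 1` play a role. -/
abbrev AdversarySeq (A : Type) : Type := (m : ℕ) → Finset (Adversary A m)

/-- `width(Ω_m)`, the sum of the sizes of its adversaries. -/
def width {A : Type} {m : ℕ} (Ω : Finset (Adversary A m)) : ℕ := ∑ B ∈ Ω, B.card

/-- `Ω` is polynomially bounded. -/
def PolynomiallyBounded {A : Type} (Ω : AdversarySeq A) : Prop :=
  ∃ p : Polynomial ℕ, ∀ m, 1 ≤ m → width (Ω m) ≤ p.eval m

/-- The interpretation of the `m` constants `c₁, …, c_m` in the product, over all adversaries `B`
of `Ω_m` and all `μ ∈ B`, of the expansions of `A` by `c_j ↦ μ(j)`. -/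
def productConstant {A : Type} {m : ℕ} (Ω : Finset (Adversary A m)) (j : Fin m) :
    (Σ B : {B // B ∈ Ω}, {μ // μ ∈ B.1}) → A :=
  fun x => x.2.1 j

/-- `Ω_m` is not degenerate: in that product the `m` constants are pairwise distinct. -/
def NonDegenerate {A : Type} {m : ℕ} (Ω : Finset (Adversary A m)) : Prop :=
  Function.Injective (productConstant Ω)

/-- `Ω_m` generates the adversary `S`: each tuple of `S` is the image of finitely many tuples, each
lying in some adversary of `Ω_m`, under a polymorphism of `A` (applied coordinatewise). -/
def Generates (L : FirstOrder.Language.{0, 0}) {A : Type} [L.Structure A] {m : ℕ}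
    (Ω : Finset (Adversary A m)) (S : Adversary A m) : Prop :=
  ∀ t ∈ S, ∃ (k : ℕ) (_ : 1 ≤ k) (f : Polymorphism L A k) (ts : Fin k → Fin m → A),
    (∀ r, ∃ B ∈ Ω, ts r ∈ B) ∧ ∀ i, f (fun r => ts r i) = t i

/-- Split the `m * n` positions into `m` consecutive blocks of size `n`; keep in block `j` only
its position `s j`. -/
def projectAdversary {A : Type} [DecidableEq A] {m n : ℕ} (B : Adversary A (m * n))
    (s : Fin m → Fin n) : Adversary A m :=
  B.image (fun t j => t (finProdFinEquiv (j, s j)))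

/-- `Ω` is projective: with `n = |A|`, for all `m ≥ 1` and `B ∈ Ω_{n·m}` there is one adversary of
`Ω_m` that dominates all the projections of `B` with one position kept in each block. -/
def Projective {A : Type} [Fintype A] [DecidableEq A] (Ω : AdversarySeq A) : Prop :=
  ∀ m, 1 ≤ m → ∀ B ∈ Ω (m * Fintype.card A), ∃ D ∈ Ω m,
    ∀ s : Fin m → Fin (Fintype.card A), projectAdversary B s ⊆ D

/-- The alphabet over which a set of adversaries is written. -/
inductive AdvSym (A : Type) where
  | elem : A → AdvSym A
  | tupleEnd : AdvSym A
  | advEnd : AdvSym A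

/-- A list of lists of tuples as a word. -/
def encodeAdversaries {A : Type} {m : ℕ} (l : List (List (Fin m → A))) : List (AdvSym A) :=
  (l.map fun B =>
    (B.map fun t => (List.ofFn t).map AdvSym.elem ++ [AdvSym.tupleEnd]).flatten
      ++ [AdvSym.advEnd]).flatten

/-- `Ω` is effective: a Turing machine which is given `m ≥ 1` in unary writes out `Ω_m`
(all its adversaries, each one as the list of its tuples, in some order)
in time polynomial in `m + width(Ω_m)`. -/
def Effective {A : Type} [DecidableEq A] (Ω : AdversarySeq A) : Prop :=
  ∃ (enum : (m : ℕ) → List (List (Fin m → A))) (p : Polynomial ℕ)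
    (M : Turing.TM2ComputableAux Unit (AdvSym A)),
    ∀ m, 1 ≤ m →
      ((enum m).map List.toFinset).toFinset = Ω m ∧
      Nonempty (Turing.TM2OutputsInTime M.tm
        ((List.replicate m ()).map M.inputAlphabet.invFun)
        (some ((encodeAdversaries (enum m)).map M.outputAlphabet.invFun))
        (p.eval (m + width (Ω m))))

end QCSPReduction

/-!
A sentence with `N` variables holds if and only if the existential player wins the game in which
the players choose the values of the variables one after the other. It is enough to win against the
tuples of the adversaries in `Ω (N + 1)`, by plays which do not look ahead. Indeed, generation of
the tuples of length `(N + 1) * |A|` gives a polymorphism `f` and, for every position `j` and every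
`a : A`, elements `e s j a` with `f (fun s => e s j a) = a`; by projectivity, each choice of one
value `x j` for every position makes `fun j => e s j (x j)` a tuple of an adversary in `Ω (N + 1)`.
Applying `f` coordinatewise to the plays against these tuples gives a play against `x`, and it does
not look ahead because `e s j (x j)` depends only on `x j`.

That there are such plays is expressed by a primitive positive sentence, which has one copy of
every variable for each tuple. A copy of a universal variable is equal to the constant prescribed
by the tuple, and two copies of an existential variable are identified when their tuples agree on
the earlier positions.

To write this sentence in polynomial time, a machine computes the unary number `N + 1`, runs the
machine which enumerates `Ω (N + 1)`, and rearranges the words which it has. Rearrangements are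
composed from passes over a word which see, at each letter, the part read before; polynomial
time is preserved because such a pass repeats its body only as often as the word is long.
-/

namespace QCSPReduction

/-! ### Stack machines -/

open Turing (TM2.Stmt TM2.Cfg TM2.step TM2.stepAux)

section Steps

variable {K : Type} [DecidableEq K] {Γ : K → Type} {Λ σ : Type}

/-- `Steps M n c c'` says that `M` takes the configuration `c` to `c'` in exactly `n` steps. -/
inductive Steps (M : Λ → TM2.Stmt Γ Λ σ) : ℕ → TM2.Cfg Γ Λ σ → TM2.Cfg Γ Λ σ → Prop
  | refl (c) : Steps M 0 c c
  | head {n c c₁ c'} : TM2.step M c = some c₁ → Steps M n c₁ c' → Steps M (n + 1) c c'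

theorem Steps.trans {M : Λ → TM2.Stmt Γ Λ σ} {n n' : ℕ} {c c' c'' : TM2.Cfg Γ Λ σ}
    (h : Steps M n c c') (h' : Steps M n' c' c'') : Steps M (n + n') c c'' := by
  induction h with
  | refl => rwa [Nat.zero_add]
  | head h₁ _ ih => rw [Nat.add_right_comm]; exact .head h₁ (ih h')

theorem Steps.map {Λ' σ' K' : Type} [DecidableEq K'] {Γ' : K' → Type}
    {M : Λ → TM2.Stmt Γ Λ σ} {M' : Λ' → TM2.Stmt Γ' Λ' σ'}
    (F : TM2.Cfg Γ Λ σ → TM2.Cfg Γ' Λ' σ')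
    (hF : ∀ l v S, TM2.step M' (F ⟨some l, v, S⟩) = some (F (TM2.stepAux (M l) v S)))
    {n : ℕ} {c c' : TM2.Cfg Γ Λ σ} (h : Steps M n c c') : Steps M' n (F c) (F c') := by
  induction h with
  | refl => exact .refl _
  | @head _ c _ _ h₁ _ ih =>
    obtain ⟨_ | l, v, S⟩ := c
    · simp [TM2.step] at h₁
    · cases h₁
      exact .head (hF l v S) ih

theorem steps_iff_iterate {M : Λ → TM2.Stmt Γ Λ σ} {n : ℕ} {c c' : TM2.Cfg Γ Λ σ} :
    Steps M n c c' ↔ (flip bind (TM2.step M))^[n] (some c) = some c' := by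
  constructor
  · intro h
    induction h with
    | refl => rfl
    | @head n c c₁ c' h₁ _ ih =>
      rwa [Function.iterate_succ_apply, show flip bind (TM2.step M) (some c) = some c₁ from h₁]
  · induction n generalizing c with
    | zero => rintro ⟨⟩; exact .refl _
    | succ n ih =>
      rw [Function.iterate_succ_apply]
      intro h
      rcases h₁ : TM2.step M c with _ | c₁
      · rw [show flip bind (TM2.step M) (some c) = none from h₁,
          Function.iterate_fixed (by rfl)] at h
        cases h
      · rw [show flip bind (TM2.step M) (some c) = some c₁ from h₁] at h
        exact .head h₁ (ih h)

/-- The number of push instructions of a statement. -/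
def pushCount : TM2.Stmt Γ Λ σ → ℕ
  | .push _ _ q => pushCount q + 1
  | .peek _ _ q | .pop _ _ q | .load _ q => pushCount q
  | .branch _ q₁ q₂ => pushCount q₁ + pushCount q₂
  | .goto _ | .halt => 0

theorem length_stepAux_le (q : TM2.Stmt Γ Λ σ) (v : σ) (S : ∀ k, List (Γ k)) (k : K) :
    ((TM2.stepAux q v S).stk k).length ≤ (S k).length + pushCount q := by
  induction q generalizing v S with
  | push k' f q ih | pop k' f q ih =>
    refine (ih _ _).trans ?_
    rcases eq_or_ne k k' with rfl | h <;> simp [pushCount, *] <;> omega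
  | peek _ _ _ ih | load _ _ ih => exact ih _ _
  | branch f q₁ q₂ ih₁ ih₂ =>
    cases h : f v
    · simpa [h, pushCount] using (ih₂ v S).trans (by omega)
    · simpa [h, pushCount] using (ih₁ v S).trans (by omega)
  | goto f | halt => simp

theorem exists_length_le_of_steps [Finite Λ] (M : Λ → TM2.Stmt Γ Λ σ) :
    ∃ b, ∀ n c c', Steps M n c c' → ∀ k, (c'.stk k).length ≤ (c.stk k).length + b * n := by
  have := Fintype.ofFinite Λ
  refine ⟨∑ l, pushCount (M l), fun n c c' h k => ?_⟩
  induction h with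
  | refl => exact Nat.le_add_right _ _
  | @head n c c₁ c' h₁ _ ih =>
    obtain ⟨_ | l, v, S⟩ := c
    · simp [TM2.step] at h₁
    cases h₁
    have hl : pushCount (M l) ≤ ∑ l, pushCount (M l) :=
      Finset.single_le_sum_of_canonicallyOrdered (f := fun l => pushCount (M l))
        (Finset.mem_univ l)
    have := length_stepAux_le (M l) v S k
    rw [Nat.mul_succ]
    exact ih.trans (by dsimp only; omega)

end Steps

section Relabel

variable {K : Type} [DecidableEq K] {Γ : K → Type} {Λ Λ' σ : Type}

/-- Rename the labels of a statement, and continue at `x` where it halts; this is how the code of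
one program is placed inside another one. -/
def relabel (e : Λ → Λ') (x : Option Λ') : TM2.Stmt Γ Λ σ → TM2.Stmt Γ Λ' σ
  | .push k f q => .push k f (relabel e x q)
  | .peek k f q => .peek k f (relabel e x q)
  | .pop k f q => .pop k f (relabel e x q)
  | .load f q => .load f (relabel e x q)
  | .branch f q₁ q₂ => .branch f (relabel e x q₁) (relabel e x q₂)
  | .goto f => .goto fun v => e (f v)
  | .halt => x.elim .halt fun l => .goto fun _ => l

/-- The effect of `relabel` on configurations. -/
def relabelCfg (e : Λ → Λ') (x : Option Λ') (c : TM2.Cfg Γ Λ σ) : TM2.Cfg Γ Λ' σ :=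
  ⟨c.l.elim x fun l => some (e l), c.var, c.stk⟩

theorem stepAux_relabel (e : Λ → Λ') (x : Option Λ') (q : TM2.Stmt Γ Λ σ) (v : σ)
    (S : ∀ k, List (Γ k)) :
    TM2.stepAux (relabel e x q) v S = relabelCfg e x (TM2.stepAux q v S) := by
  induction q generalizing v S with
  | push k f q ih | peek k f q ih | pop k f q ih | load f q ih => simp [relabel, ih]
  | branch f q₁ q₂ ih₁ ih₂ => cases h : f v <;> simp [relabel, ih₁, ih₂, h]
  | goto f => simp [relabel, relabelCfg]
  | halt => cases x <;> simp [relabel, relabelCfg]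

theorem Steps.relabel {M : Λ → TM2.Stmt Γ Λ σ} {M' : Λ' → TM2.Stmt Γ Λ' σ} (e : Λ → Λ')
    (x : Option Λ') (hM' : ∀ l, M' (e l) = relabel e x (M l)) {n : ℕ} {c c' : TM2.Cfg Γ Λ σ}
    (h : Steps M n c c') : Steps M' n (relabelCfg e x c) (relabelCfg e x c') :=
  h.map (relabelCfg e x) fun l v S =>
    congrArg some ((congrArg (TM2.stepAux · v S) (hM' l)).trans (stepAux_relabel ..))

end Relabel

/-- A stack program with a single entry, which it leaves by halting. The internal state holds the
last symbol read, as a letter of `α`, next to a component `ρ` for the use of subroutines. -/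
structure Program {K : Type} (Γ : K → Type) (α ρ : Type) where
  Label : Type
  finite_label : Finite Label
  main : Label
  code : Label → TM2.Stmt Γ Label (Option α × ρ)

namespace Program

variable {K : Type} [DecidableEq K] {Γ : K → Type} {α ρ : Type}

/-- From any internal state, `P` turns the stacks `S` into `S'` in at most `t` steps. -/
def Run (P : Program Γ α ρ) (S S' : ∀ k, List (Γ k)) (t : ℕ) : Prop :=
  ∀ v, ∃ v', ∃ n ≤ t, Steps P.code n ⟨some P.main, v, S⟩ ⟨none, v', S'⟩

theorem Run.mono {P : Program Γ α ρ} {S S' : ∀ k, List (Γ k)} {t t' : ℕ} (h : P.Run S S' t)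
    (ht : t ≤ t') : P.Run S S' t' := fun v =>
  let ⟨v', n, hn, h'⟩ := h v
  ⟨v', n, hn.trans ht, h'⟩

/-- The program that does nothing. -/
def skip : Program Γ α ρ := ⟨Unit, inferInstance, (), fun _ => .halt⟩

theorem run_skip (S : ∀ k, List (Γ k)) : (skip : Program Γ α ρ).Run S S 1 := fun v =>
  ⟨v, 1, le_rfl, .head rfl (.refl _)⟩

/-- Push a symbol. -/
def push (k : K) (a : Γ k) : Program Γ α ρ :=
  ⟨Unit, inferInstance, (), fun _ => .push k (fun _ => a) .halt⟩

theorem run_push (k : K) (a : Γ k) (S : ∀ k, List (Γ k)) :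
    (push k a : Program Γ α ρ).Run S (Function.update S k (a :: S k)) 1 := fun v =>
  ⟨v, 1, le_rfl, .head rfl (.refl _)⟩

/-- Sequential composition. -/
def seq (P Q : Program Γ α ρ) : Program Γ α ρ where
  Label := P.Label ⊕ Q.Label
  finite_label := have := P.finite_label; have := Q.finite_label; inferInstance
  main := .inl P.main
  code := Sum.elim (fun l => relabel .inl (some (.inr Q.main)) (P.code l))
    (fun l => relabel .inr none (Q.code l))

theorem Run.seq {P Q : Program Γ α ρ} {S S' S'' : ∀ k, List (Γ k)} {t t' : ℕ} (h : P.Run S S' t)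
    (h' : Q.Run S' S'' t') : (P.seq Q).Run S S'' (t + t') := fun v => by
  obtain ⟨v₁, n₁, hn₁, h₁⟩ := h v
  obtain ⟨v₂, n₂, hn₂, h₂⟩ := h' v₁
  have h₁' := h₁.relabel (M' := (P.seq Q).code) .inl (some (.inr Q.main)) fun _ => rfl
  have h₂' := h₂.relabel (M' := (P.seq Q).code) .inr none fun _ => rfl
  exact ⟨v₂, n₁ + n₂, by omega, h₁'.trans h₂'⟩

/-- Pop a symbol, read it as a letter by means of `g`, and branch on it. -/
def pop [Finite α] (k : K) (g : Γ k → α) (P : Option α → Program Γ α ρ) : Program Γ α ρ where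
  Label := Unit ⊕ Σ o, (P o).Label
  finite_label := have := fun o => (P o).finite_label; inferInstance
  main := .inl ()
  code := Sum.elim
    (fun _ => .pop k (fun v o => (o.map g, v.2)) (.goto fun v => .inr ⟨v.1, (P v.1).main⟩))
    (fun l => relabel (fun l' => .inr ⟨l.1, l'⟩) none ((P l.1).code l.2))

theorem Run.pop [Finite α] {k : K} {g : Γ k → α} {P : Option α → Program Γ α ρ}
    {S S' : ∀ k, List (Γ k)} {t : ℕ}
    (h : (P ((S k).head?.map g)).Run (Function.update S k (S k).tail) S' t) :
    (pop k g P).Run S S' (t + 1) := fun v => by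
  obtain ⟨v', n, hn, h⟩ := h ((S k).head?.map g, v.2)
  have h' := h.relabel (M' := (Program.pop k g P).code) (fun l' => .inr ⟨_, l'⟩) none fun _ => rfl
  exact ⟨v', n + 1, by omega, .head rfl h'⟩

/-- Pop the symbols of a stack until it is empty, running a program after each pop. -/
def loop [Finite α] (k : K) (g : Γ k → α) (P : α → Program Γ α ρ) : Program Γ α ρ where
  Label := Unit ⊕ Σ a, (P a).Label
  finite_label := have := fun o => (P o).finite_label; inferInstance
  main := .inl ()
  code := Sum.elim
    (fun _ => .pop k (fun v o => (o.map g, v.2)) (.branch (fun v => v.1.isNone) .halt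
      (.goto fun v => v.1.elim (.inl ()) fun a => .inr ⟨a, (P a).main⟩)))
    (fun l => relabel (fun l' => .inr ⟨l.1, l'⟩) (some (.inl ())) ((P l.1).code l.2))

theorem run_loop_nil [Finite α] {k : K} (g : Γ k → α) (P : α → Program Γ α ρ)
    {S : ∀ k, List (Γ k)} (h : S k = []) : (loop k g P).Run S S 1 := fun v => by
  refine ⟨(none, v.2), 1, le_rfl, .head ?_ (.refl _)⟩
  have hS : Function.update S k [] = S := by rw [← h, Function.update_eq_self]
  simp [loop, h, hS]

theorem run_loop_cons [Finite α] {k : K} {g : Γ k → α} {P : α → Program Γ α ρ}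
    {S S' S'' : ∀ k, List (Γ k)} {a : Γ k} {l : List (Γ k)} {t t' : ℕ} (hS : S k = a :: l)
    (h : (P (g a)).Run (Function.update S k l) S' t) (h' : (loop k g P).Run S' S'' t') :
    (loop k g P).Run S S'' (t + t' + 1) := fun v => by
  obtain ⟨v₁, n₁, hn₁, h₁⟩ := h (some (g a), v.2)
  obtain ⟨v₂, n₂, hn₂, h₂⟩ := h' v₁
  have h₁' := h₁.relabel (M' := (loop k g P).code) (fun l' => .inr ⟨g a, l'⟩) (some (.inl ()))
    fun _ => rfl
  refine ⟨v₂, n₁ + n₂ + 1, by omega, .head ?_ (h₁'.trans h₂)⟩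
  simp [loop, hS, relabelCfg]

/-- The rule for loops: the stacks are `I u l` when the word `u.reverse` has been read and the word
`l` is still to be read. -/
theorem run_loop [Finite α] {k : K} {g : Γ k → α} {P : α → Program Γ α ρ} {t : ℕ}
    {I : List (Γ k) → List (Γ k) → ∀ k, List (Γ k)} {w : List (Γ k)} (hI : ∀ u l, I u l k = l)
    (h : ∀ u a l, u.reverse ++ a :: l = w →
      (P (g a)).Run (Function.update (I u (a :: l)) k l) (I (a :: u) l) t) :
    (loop k g P).Run (I [] w) (I w.reverse []) ((t + 1) * w.length + 1) := by
  suffices ∀ l u, u.reverse ++ l = w →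
      (loop k g P).Run (I u l) (I w.reverse []) ((t + 1) * l.length + 1) from this w [] rfl
  intro l
  induction l with
  | nil =>
    rintro u hu
    rw [← hu, List.append_nil, List.reverse_reverse]
    exact run_loop_nil g P (hI u [])
  | cons a l ih =>
    intro u hu
    refine (run_loop_cons (hI _ _) (h u a l hu) (ih (a :: u) (by simpa using hu))).mono ?_
    rw [List.length_cons, Nat.mul_succ]
    omega

/-- Empty a stack. -/
def clear [Finite α] (k : K) (g : Γ k → α) : Program Γ α ρ := loop k g fun _ => skip

theorem run_clear [Finite α] (k : K) (g : Γ k → α) (S : ∀ k, List (Γ k)) :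
    (clear k g : Program Γ α ρ).Run S (Function.update S k []) (2 * (S k).length + 1) := by
  have h := run_loop (g := g) (P := fun _ => (skip : Program Γ α ρ)) (w := S k)
    (I := fun _ l => Function.update S k l) (fun _ _ => Function.update_self ..)
    (fun u a l _ => by simpa only [Function.update_idem] using run_skip _)
  rwa [Function.update_eq_self] at h

/-- Pop the symbols of the stack `k` until it is empty, pushing each of them onto the stack `k'`
(so that their order is reversed). -/
def move [Finite α] (k k' : K) (g : Γ k → α) (g' : α → Γ k') : Program Γ α ρ :=
  loop k g fun a => push k' (g' a)

theorem run_move [Finite α] {k k' : K} (hk : k ≠ k') (g : Γ k → α) (g' : α → Γ k')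
    (S : ∀ k, List (Γ k)) :
    (move k k' g g' : Program Γ α ρ).Run S
      (Function.update (Function.update S k []) k' ((S k).reverse.map (g' ∘ g) ++ S k'))
      (2 * (S k).length + 1) := by
  let I (u l : List (Γ k)) : ∀ k, List (Γ k) :=
    Function.update (Function.update S k l) k' (u.map (g' ∘ g) ++ S k')
  have hstep (u : List (Γ k)) (a : Γ k) (l : List (Γ k)) :
      (push k' (g' (g a)) : Program Γ α ρ).Run (Function.update (I u (a :: l)) k l)
        (I (a :: u) l) 1 := by
    have h := run_push (α := α) (ρ := ρ) k' (g' (g a)) (I u l)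
    simpa [I, Function.update_comm hk.symm] using h
  have h := run_loop (w := S k) (P := fun a => push k' (g' a)) (fun _ _ => by simp [I, hk])
    fun u a l _ => hstep u a l
  simpa [I, move] using h

end Program

/-- The stacks of a machine which works on an input stack, an output stack, registers `X` and
the stacks `K` of a subroutine. -/
inductive Loc (X K : Type) where
  | input : Loc X K
  | output : Loc X K
  | reg : X → Loc X K
  | sub : K → Loc X K
  deriving DecidableEq, Fintype

namespace Loc

variable {X K I O α : Type} {Γ : K → Type}

/-- The alphabets of the stacks: all registers share the alphabet `α`. -/
abbrev Alphabet (I O α : Type) (Γ : K → Type) : Loc X K → Type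
  | .input => I
  | .output => O
  | .reg _ => α
  | .sub k => Γ k

/-- The contents of all the stacks. -/
def store (x : List I) (y : List O) (R : X → List α) (T : ∀ k, List (Γ k)) :
    ∀ k, List (Alphabet (X := X) I O α Γ k)
  | .input => x
  | .output => y
  | .reg j => R j
  | .sub k => T k

theorem store_nil :
    store (X := X) (I := I) (O := O) (α := α) (Γ := Γ) [] [] (fun _ => []) (fun _ => []) =
      fun _ => [] := by
  funext k; cases k <;> rfl

variable [DecidableEq X] [DecidableEq K] (x x' : List I) (y y' : List O) (R : X → List α)
  (T : ∀ k, List (Γ k))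

@[simp]
theorem update_store_input :
    Function.update (store x y R T) .input x' = store x' y R T := by
  funext k; cases k <;> rfl

@[simp]
theorem update_store_output :
    Function.update (store x y R T) .output y' = store x y' R T := by
  funext k; cases k <;> rfl

@[simp]
theorem update_store_reg (j : X) (w : List α) :
    Function.update (store x y R T) (.reg j) w = store x y (Function.update R j w) T := by
  funext k
  rcases k with _ | _ | i | _
  · rfl
  · rfl
  · rcases eq_or_ne i j with rfl | h
    · simp [store]
    · simp [store, h]
  · rfl

@[simp]
theorem update_store_sub (k : K) (w : List (Γ k)) :
    Function.update (store x y R T) (.sub k) w = store x y R (Function.update T k w) := by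
  funext j
  rcases j with _ | _ | _ | i
  · rfl
  · rfl
  · rfl
  · rcases eq_or_ne i k with rfl | h
    · simp [store]
    · simp [store, h]

end Loc

section Call

open Loc (Alphabet store)

variable {X K I O α ρ Λ σ : Type} {Γ : K → Type}

/-- The statement of a subroutine as one of the calling machine. -/
def embed : TM2.Stmt Γ Λ ρ → TM2.Stmt (Alphabet (X := X) I O α Γ) Λ (σ × ρ)
  | .push k f q => .push (.sub k) (fun v => f v.2) (embed q)
  | .peek k f q => .peek (.sub k) (fun v o => (v.1, f v.2 o)) (embed q)
  | .pop k f q => .pop (.sub k) (fun v o => (v.1, f v.2 o)) (embed q)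
  | .load f q => .load (fun v => (v.1, f v.2)) (embed q)
  | .branch f q₁ q₂ => .branch (fun v => f v.2) (embed q₁) (embed q₂)
  | .goto f => .goto fun v => f v.2
  | .halt => .halt

variable [DecidableEq X] [DecidableEq K]

/-- The effect of `embed` on configurations. -/
def embedCfg (x : List I) (y : List O) (R : X → List α) (u : σ) (c : TM2.Cfg Γ Λ ρ) :
    TM2.Cfg (Alphabet (X := X) I O α Γ) Λ (σ × ρ) :=
  ⟨c.l, (u, c.var), store x y R c.stk⟩

theorem stepAux_embed (x : List I) (y : List O) (R : X → List α) (u : σ) (q : TM2.Stmt Γ Λ ρ)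
    (v : ρ) (T : ∀ k, List (Γ k)) :
    TM2.stepAux (embed q) (u, v) (store x y R T) = embedCfg x y R u (TM2.stepAux q v T) := by
  induction q generalizing v T with
  | push k f q ih | pop k f q ih =>
    exact (congrArg (TM2.stepAux (embed q) _) (Loc.update_store_sub ..)).trans (ih _ _)
  | peek _ _ _ ih | load _ _ ih => exact ih _ _
  | branch f q₁ q₂ ih₁ ih₂ => cases h : f v <;> simp [embed, ih₁, ih₂, h]
  | goto f | halt => rfl

/-- Run a machine from its initial state. -/
def Program.call [Finite Λ] (main : Λ) (init : ρ) (M : Λ → TM2.Stmt Γ Λ ρ) :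
    Program (Alphabet (X := X) I O α Γ) α ρ where
  Label := Unit ⊕ Λ
  finite_label := inferInstance
  main := .inl ()
  code := Sum.elim (fun _ => .load (fun v => (v.1, init)) (.goto fun _ => .inr main))
    (fun l => relabel .inr none (embed (M l)))

theorem Program.run_call [Finite Λ] {main : Λ} {init v' : ρ} {M : Λ → TM2.Stmt Γ Λ ρ}
    {T T' : ∀ k, List (Γ k)} {n : ℕ} (x : List I) (y : List O) (R : X → List α)
    (h : Steps M n ⟨some main, init, T⟩ ⟨none, v', T'⟩) :
    (call main init M : Program (Alphabet I O α Γ) α ρ).Run (store x y R T) (store x y R T')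
      (n + 1) := fun v => by
  have h₁ := h.map (M' := fun l => embed (M l)) (embedCfg x y R v.1)
    fun l v' T => congrArg some (stepAux_embed x y R v.1 (M l) v' T)
  have h₂ := h₁.relabel (M' := (call main init M : Program (Alphabet I O α Γ) α ρ).code) .inr none
    fun _ => rfl
  exact ⟨(v.1, v'), n + 1, le_rfl, .head rfl h₂⟩

end Call

/-! ### Programs with registers -/

section Layout

/-- A choice, among the registers `X` of a machine, of registers holding `n` words, of a register
onto which an output is pushed, and of auxiliary registers `D`. -/
structure Layout (X : Type) (n : ℕ) (D : Type) where
  reg : Fin n → X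
  out : X
  aux : D ↪ X
  reg_ne_out : ∀ i, reg i ≠ out
  reg_ne_aux : ∀ i j, reg i ≠ aux j
  aux_ne_out : ∀ j, aux j ≠ out

namespace Layout

variable {X D D' : Type} {n : ℕ} (L : Layout X n D)

/-- Keep only some of the auxiliary registers. -/
@[simps]
def restrict (e : D' ↪ D) : Layout X n D' where
  reg := L.reg
  out := L.out
  aux := e.trans L.aux
  reg_ne_out := L.reg_ne_out
  reg_ne_aux i j := L.reg_ne_aux i (e j)
  aux_ne_out j := L.aux_ne_out (e j)

/-- Write the output to the auxiliary register `j`. -/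
@[simps]
def redirect (j : D) (e : D' ↪ D) (hj : ∀ i, e i ≠ j) : Layout X n D' where
  reg := L.reg
  out := L.aux j
  aux := e.trans L.aux
  reg_ne_out i := L.reg_ne_aux i j
  reg_ne_aux i j := L.reg_ne_aux i (e j)
  aux_ne_out i := L.aux.injective.ne (hj i)

/-- Use the auxiliary register `j` for a new word, which gets the index `0`. -/
@[simps]
def bind (j : D) (e : D' ↪ D) (hj : ∀ i, e i ≠ j) : Layout X (n + 1) D' where
  reg := Fin.cons (L.aux j) L.reg
  out := L.out
  aux := e.trans L.aux
  reg_ne_out := Fin.cases (L.aux_ne_out j) L.reg_ne_out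
  reg_ne_aux := Fin.cases (fun i => (L.aux.injective.ne (hj i)).symm) fun i j =>
    L.reg_ne_aux i (e j)
  aux_ne_out i := L.aux_ne_out (e i)

/-- Forget or permute some of the words. -/
@[simps]
def rename {m : ℕ} (e : Fin m → Fin n) : Layout X m D where
  reg := L.reg ∘ e
  out := L.out
  aux := L.aux
  reg_ne_out i := L.reg_ne_out (e i)
  reg_ne_aux i := L.reg_ne_aux (e i)
  aux_ne_out := L.aux_ne_out

end Layout

end Layout

section Computes

open Loc (Alphabet store)
open Program (skip push pop loop clear move)

variable {X I O K α ρ D : Type} [DecidableEq X] [DecidableEq K] {Γ : K → Type} {n : ℕ}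

/-- The concatenation of the words `F p a`, for `a` running through the letters of a word and `p`
being the part of the word before `a`, reversed, on top of an initial context. -/
def scan (F : List α → α → List α) : List α → List α → List α
  | _, [] => []
  | p, a :: w => F p a ++ scan F (a :: p) w

/-- In the layout `L`, the program `P` pushes the word `f S` onto the output register, where `S`
are the words in the registers; it takes time `t N` if their lengths are at most `N`. The auxiliary
registers have to be empty initially, and are empty in the end. -/
def Program.Computes (P : Program (Alphabet (X := X) I O α Γ) α ρ) (L : Layout X n D)
    (f : (Fin n → List α) → List α) (t : ℕ → ℕ) : Prop :=
  ∀ (x : List I) (y : List O) (R : X → List α) (T : ∀ k, List (Γ k)) (S : Fin n → List α) (N : ℕ),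
    (∀ i, R (L.reg i) = S i) → (∀ j, R (L.aux j) = []) → (∀ i, (S i).length ≤ N) →
    P.Run (store x y R T) (store x y (Function.update R L.out (f S ++ R L.out)) T) (t N)

section Registers

variable (x : List I) (y : List O) (R : X → List α) (T : ∀ k, List (Γ k))

theorem run_push_reg (j : X) (a : α) :
    (push (.reg j) a : Program (Alphabet I O α Γ) α ρ).Run (store x y R T)
      (store x y (Function.update R j (a :: R j)) T) 1 := by
  simpa [store] using Program.run_push (α := α) (ρ := ρ) (.reg j) a (store x y R T)

theorem run_move_reg [Finite α] {j j' : X} (h : j ≠ j') :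
    (move (.reg j) (.reg j') id id : Program (Alphabet I O α Γ) α ρ).Run (store x y R T)
      (store x y (Function.update (Function.update R j []) j' ((R j).reverse ++ R j')) T)
      (2 * (R j).length + 1) := by
  simpa [store] using Program.run_move (α := α) (ρ := ρ) (k := .reg j) (k' := .reg j')
    (by simpa using h) id id (store x y R T)

theorem run_clear_reg [Finite α] (j : X) :
    (clear (.reg j) id : Program (Alphabet I O α Γ) α ρ).Run (store x y R T)
      (store x y (Function.update R j []) T) (2 * (R j).length + 1) := by
  simpa [store] using Program.run_clear (α := α) (ρ := ρ) (.reg j) id (store x y R T)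

theorem run_loop_reg [Finite α] {j : X} {P : α → Program (Alphabet I O α Γ) α ρ} {t : ℕ}
    {J : List α → List α → X → List α} {w : List α} (hJ : ∀ u l, J u l j = l)
    (h : ∀ u a l, u.reverse ++ a :: l = w →
      (P a).Run (store x y (Function.update (J u (a :: l)) j l) T) (store x y (J (a :: u) l) T) t) :
    (loop (.reg j) id P).Run (store x y (J [] w) T) (store x y (J w.reverse []) T)
      ((t + 1) * w.length + 1) :=
  Program.run_loop (K := Loc X K) (k := .reg j) (I := fun u l => store x y (J u l) T) hJ
    fun u a l hw => by simpa using h u a l hw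

/-- Push a copy of the word in the register `j` onto the register `j'`, by way of the register
`i`. -/
def copy [Finite α] (j i j' : X) : Program (Alphabet (X := X) I O α Γ) α ρ :=
  .seq (move (.reg j) (.reg i) id id)
    (loop (.reg i) id fun a => .seq (push (.reg j) a) (push (.reg j') a))

theorem run_copy [Finite α] {j i j' : X} (hji : j ≠ i) (hjj' : j ≠ j') (hij' : i ≠ j')
    (hi : R i = []) :
    (copy j i j' : Program (Alphabet I O α Γ) α ρ).Run (store x y R T)
      (store x y (Function.update R j' (R j ++ R j')) T) (5 * (R j).length + 2) := by
  let J (u l : List α) : X → List α :=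
    Function.update (Function.update (Function.update R i l) j u) j' (u ++ R j')
  have hmove := run_move_reg (ρ := ρ) x y R T hji
  have hloop := run_loop_reg (ρ := ρ) x y T (j := i) (w := (R j).reverse) (t := 2)
    (P := fun a => .seq (push (.reg j) a) (push (.reg j') a))
    (J := J)
    (by simp [J, hji.symm, hij'])
    fun u a l _ => ?_
  · have hstart : J [] (R j).reverse =
        Function.update (Function.update R j []) i ((R j).reverse ++ R i) := by
      funext k
      simp only [J, Function.update_apply]
      grind
    have hend : J (R j).reverse.reverse [] = Function.update R j' (R j ++ R j') := by
      funext k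
      simp only [J, Function.update_apply]
      grind
    rw [hstart, hend] at hloop
    exact (hmove.seq hloop).mono (by rw [List.length_reverse]; omega)
  · have h := (run_push_reg (ρ := ρ) x y (Function.update (J u (a :: l)) i l) T j a).seq
      (run_push_reg (ρ := ρ) x y _ T j' a)
    convert h using 2
    funext k
    simp only [J, Function.update_apply]
    grind

end Registers

theorem computes_skip (L : Layout X n D) :
    (skip : Program (Alphabet I O α Γ) α ρ).Computes L (fun _ => []) fun _ => 1 :=
  fun x y R T _ _ _ _ _ => by simpa using Program.run_skip (store x y R T)

theorem Program.Computes.cons {P : Program (Alphabet I O α Γ) α ρ} {L : Layout X n D}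
    {f : (Fin n → List α) → List α} {t : ℕ → ℕ} (h : P.Computes L f t) (a : α) :
    (P.seq (push (.reg L.out) a)).Computes L (fun S => a :: f S) fun N => t N + 1 :=
  fun x y R T S N hS hD hN => by
    simpa using (h x y R T S N hS hD hN).seq (run_push_reg x y _ T L.out a)

theorem Program.Computes.append {D₁ D₂ : Type} {P Q : Program (Alphabet I O α Γ) α ρ}
    {L : Layout X n (D₁ ⊕ D₂)} {f g : (Fin n → List α) → List α} {t u : ℕ → ℕ}
    (hf : P.Computes (L.restrict .inl) f t) (hg : Q.Computes (L.restrict .inr) g u) :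
    (Q.seq P).Computes L (fun S => f S ++ g S) fun N => u N + t N :=
  fun x y R T S N hS hD hN => by
    have h₁ := hg x y R T S N hS (fun j => hD (.inr j)) hN
    have h₂ := hf x y (Function.update R L.out (g S ++ R L.out)) T S N
      (fun i => by simp [L.reg_ne_out, hS])
      (fun j => by simp [L.aux_ne_out, hD]) hN
    simpa using h₁.seq h₂

theorem computes_reg [Finite α] (L : Layout X n Unit) (i : Fin n) :
    (copy (L.reg i) (L.aux ()) L.out : Program (Alphabet I O α Γ) α ρ).Computes L (fun S => S i)
      fun N => 5 * N + 2 :=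
  fun x y R T S N hS hD hN => by
    have h := run_copy (ρ := ρ) x y R T (L.reg_ne_aux i ()) (L.reg_ne_out i) (L.aux_ne_out ())
      (hD ())
    rw [hS] at h
    exact h.mono (by dsimp only; have := hN i; omega)

theorem Program.Computes.rename {m : ℕ} {P : Program (Alphabet I O α Γ) α ρ} {L : Layout X n D}
    {f : (Fin m → List α) → List α} {t : ℕ → ℕ} {e : Fin m → Fin n}
    (h : P.Computes (L.rename e) f t) : P.Computes L (fun S => f (S ∘ e)) t :=
  fun x y R T S N hS hD hN => h x y R T (S ∘ e) N (fun i => hS (e i)) hD fun i => hN (e i)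

theorem run_loop_scan [Finite α] {D' : α → Type} {Q : α → Program (Alphabet I O α Γ) α ρ}
    {L : Layout X n D} {j : D} {e : ∀ a, D' a ↪ D} {he : ∀ a i, e a i ≠ j}
    {F : α → (Fin (n + 1) → List α) → List α} {u : ℕ → ℕ}
    (hQ : ∀ a, (Q a).Computes (L.bind j (e a) (he a)) (F a) u) (x : List I) (y : List O)
    (R : X → List α) (T : ∀ k, List (Γ k)) {S : Fin n → List α} {w : List α} {N : ℕ}
    (hS : ∀ i, R (L.reg i) = S i) (hD : ∀ i ≠ j, R (L.aux i) = []) (hw : R (L.aux j) = w.reverse)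
    (hN : ∀ i, (S i).length ≤ N) (hwN : w.length ≤ N) :
    (loop (.reg (L.aux j)) id Q).Run (store x y R T)
      (store x y (Function.update (Function.update R (L.aux j) []) L.out
        (scan (fun p a => F a (Fin.cons p S)) [] w ++ R L.out)) T) ((u N + 1) * w.length + 1) := by
  let J (v l : List α) : X → List α := Function.update (Function.update R (L.aux j) l) L.out
    (scan (fun p a => F a (Fin.cons p S)) l v ++ R L.out)
  have hout := L.aux_ne_out
  have hloop := run_loop_reg (ρ := ρ) x y T (j := L.aux j) (P := Q) (t := u N) (w := w.reverse)
    (J := J) (by simp [J, hout]) fun v a l hv => ?_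
  · have hstart : J [] w.reverse = R := by
      funext k
      simp only [J, Function.update_apply, scan, List.nil_append]
      grind
    rwa [hstart, List.reverse_reverse, List.length_reverse] at hloop
  · have hl : l.length ≤ N := by
      have := congrArg List.length hv
      simp only [List.length_append, List.length_reverse, List.length_cons] at this
      omega
    have h := hQ a x y (Function.update (J v (a :: l)) (L.aux j) l) T (Fin.cons l S) N
      (Fin.cases (by simp) fun i => by simp [J, hS, L.reg_ne_out, L.reg_ne_aux])
      (fun i => by simp [J, hout, hD, he]) (Fin.cases hl hN)
    convert h using 2
    funext k
    simp only [J, Function.update_apply, scan, Layout.bind_out]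
    grind

theorem Program.Computes.run_move [Finite α] {D' : Type} {P : Program (Alphabet I O α Γ) α ρ}
    {L : Layout X n D} {j j' : D} {e : D' ↪ D} {he : ∀ i, e i ≠ j} {g : (Fin n → List α) → List α}
    {t : ℕ → ℕ} (hP : P.Computes (L.redirect j e he) g t) (hj : j ≠ j') (x : List I) (y : List O)
    (R : X → List α) (T : ∀ k, List (Γ k)) {S : Fin n → List α} {N b : ℕ}
    (hS : ∀ i, R (L.reg i) = S i) (hD : ∀ i, R (L.aux i) = []) (hN : ∀ i, (S i).length ≤ N)
    (hb : (g S).length ≤ b) :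
    (P.seq (move (.reg (L.aux j)) (.reg (L.aux j')) id id)).Run (store x y R T)
      (store x y (Function.update R (L.aux j') (g S).reverse) T) (t N + (2 * b + 1)) := by
  have hne : L.aux j ≠ L.aux j' := L.aux.injective.ne hj
  let R₁ := Function.update R (L.aux j) (g S)
  have h₁ : P.Run (store x y R T) (store x y R₁ T) (t N) := by
    simpa [hD] using hP x y R T S N hS (fun i => hD (e i)) hN
  have h₂ := run_move_reg (ρ := ρ) x y R₁ T hne
  have hstore : Function.update (Function.update R₁ (L.aux j) []) (L.aux j')
      ((R₁ (L.aux j)).reverse ++ R₁ (L.aux j')) =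
        Function.update R (L.aux j') (g S).reverse := by
    funext k
    simp only [R₁, Function.update_apply]
    grind
  have hlen : (R₁ (L.aux j)).length ≤ b := by simpa [R₁] using hb
  rw [hstore] at h₂
  exact (h₁.seq h₂).mono (by gcongr)

theorem Program.Computes.scan [Finite α] {D₁ : Type} {D₂ : α → Type}
    {P : Program (Alphabet I O α Γ) α ρ} {Q : α → Program (Alphabet I O α Γ) α ρ}
    {L : Layout X n (Bool ⊕ D₁ ⊕ Σ a, D₂ a)} {g : (Fin n → List α) → List α}
    {F : α → (Fin (n + 1) → List α) → List α} {t s u : ℕ → ℕ}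
    (hP : P.Computes (L.redirect (.inl false) (.trans .inl .inr) (by simp)) g t)
    (hQ : ∀ a, (Q a).Computes
      (L.bind (.inl true) (.trans (.sigmaMk a) (.trans .inr .inr)) (by simp)) (F a) u)
    (hs : ∀ S N, (∀ i, (S i).length ≤ N) → (g S).length ≤ s N) :
    Program.Computes
      (.seq (P.seq (move (.reg (L.aux (.inl false))) (.reg (L.aux (.inl true))) id id))
        (loop (.reg (L.aux (.inl true))) id Q)) L
      (fun S => scan (fun p a => F a (Fin.cons p S)) [] (g S))
      fun N => (t N + (2 * s N + 1)) + ((u (N + s N) + 1) * s N + 1) :=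
  fun x y R T S N hS hD hN => by
    have hg := hs S N hN
    have hout := L.aux_ne_out
    have h₁ := hP.run_move (by simp : Sum.inl false ≠ Sum.inl true) x y R T hS hD hN hg
    let R' := Function.update R (L.aux (.inl true)) (g S).reverse
    have h₂ := run_loop_scan (N := N + s N) (w := g S) hQ x y R' T
      (S := S) (fun i => by simp [R', hS, L.reg_ne_aux]) (fun i hi => by simp [R', hi, hD])
      (by simp [R']) (fun i => (hN i).trans (Nat.le_add_right _ _)) (by omega)
    have hend : Function.update (Function.update R' (L.aux (.inl true)) []) L.out
        (QCSPReduction.scan (fun p a => F a (Fin.cons p S)) [] (g S) ++ R' L.out) =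
          Function.update R L.out
            (QCSPReduction.scan (fun p a => F a (Fin.cons p S)) [] (g S) ++ R L.out) := by
      funext k
      simp only [R', Function.update_apply]
      grind
    rw [hend] at h₂
    exact (h₁.seq h₂).mono (by dsimp only; gcongr)

section Compare

variable [Finite α] [DecidableEq α]

/-- Remove the first letter of the register `j`; unless it is `a`, push `a` onto `j'`. -/
def compareLetter (j j' : X) (a : α) : Program (Alphabet (X := X) I O α Γ) α ρ :=
  pop (.reg j) id fun o => if o = some a then skip else push (.reg j') a

/-- Compare the words in the registers `j₀` and `j₁`, emptying them; the register `j₂` gets a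
nonempty word if they differ. -/
def compare (j₀ j₁ j₂ : X) : Program (Alphabet (X := X) I O α Γ) α ρ :=
  .seq (loop (.reg j₀) id (compareLetter j₁ j₂)) (move (.reg j₁) (.reg j₂) id id)

variable (x : List I) (y : List O) (R : X → List α) (T : ∀ k, List (Γ k))

theorem run_compareLetter {j j' : X} (h : j ≠ j') (a : α) :
    (compareLetter j j' a : Program (Alphabet I O α Γ) α ρ).Run (store x y R T)
      (store x y (Function.update (Function.update R j (R j).tail) j'
        (if (R j).head? = some a then R j' else a :: R j')) T) 2 := by
  refine Program.Run.pop ?_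
  rw [Loc.update_store_reg]
  by_cases ha : (R j).head? = some a
  · have hskip := Program.run_skip (α := α) (ρ := ρ)
      (store x y (Function.update R j (R j).tail) T)
    have hR : Function.update (Function.update R j (R j).tail) j' (R j') =
        Function.update R j (R j).tail := by
      rw [Function.update_eq_self_iff, Function.update_of_ne h.symm]
    simpa only [store, Option.map_id_fun, id, ha, if_true, hR] using hskip
  · have hpush := run_push_reg (ρ := ρ) x y (Function.update R j (R j).tail) T j' a
    simpa only [store, Option.map_id_fun, id, ha, if_false, Function.update_of_ne h.symm]
      using hpush

theorem exists_run_loop_compareLetter {j₀ j₁ j₂ : X} (h₀₁ : j₀ ≠ j₁) (h₀₂ : j₀ ≠ j₂)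
    (h₁₂ : j₁ ≠ j₂) {u : List α} (hu : R j₀ = u) :
    ∃ v c, (v = [] ∧ c = [] ↔ u = R j₁ ∧ R j₂ = []) ∧ v.length ≤ (R j₁).length ∧
      c.length ≤ u.length + (R j₂).length ∧
      (loop (.reg j₀) id (compareLetter j₁ j₂) : Program (Alphabet I O α Γ) α ρ).Run
        (store x y R T)
        (store x y (Function.update (Function.update (Function.update R j₀ []) j₁ v) j₂ c) T)
        (3 * u.length + 1) := by
  induction u generalizing R with
  | nil =>
    refine ⟨R j₁, R j₂, by grind, le_rfl, by simp, ?_⟩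
    have : Function.update (Function.update (Function.update R j₀ []) j₁ (R j₁)) j₂ (R j₂) = R := by
      funext k
      simp only [Function.update_apply]
      grind
    rw [this]
    exact Program.run_loop_nil _ _ hu
  | cons a u ih =>
    let R' := Function.update (Function.update (Function.update R j₀ u) j₁ (R j₁).tail) j₂
      (if (R j₁).head? = some a then R j₂ else a :: R j₂)
    have hR'₁ : R' j₁ = (R j₁).tail := by simp [R', h₁₂]
    have hR'₂ : R' j₂ = if (R j₁).head? = some a then R j₂ else a :: R j₂ := by simp [R']
    have hstep := run_compareLetter (ρ := ρ) x y (Function.update R j₀ u) T h₁₂ a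
    rw [Function.update_of_ne h₀₁.symm, Function.update_of_ne h₀₂.symm,
      ← Loc.update_store_reg _ _ R] at hstep
    obtain ⟨v, c, hiff, hv, hc, hrun⟩ := ih R' (by simp [R', h₀₁, h₀₂])
    refine ⟨v, c, ?_, ?_, ?_, ?_⟩
    · cases h : R j₁ <;> grind
    · grind
    · grind
    · convert Program.run_loop_cons (show store x y R T (.reg j₀) = a :: u from hu) hstep hrun
        using 2
      · funext k
        simp only [R', Function.update_apply]
        grind
      · rw [List.length_cons]
        omega

theorem exists_run_compare {j₀ j₁ j₂ : X} (h₀₁ : j₀ ≠ j₁) (h₀₂ : j₀ ≠ j₂) (h₁₂ : j₁ ≠ j₂)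
    (h₂ : R j₂ = []) :
    ∃ c, (c = [] ↔ R j₀ = R j₁) ∧ c.length ≤ (R j₀).length + (R j₁).length ∧
      (compare j₀ j₁ j₂ : Program (Alphabet I O α Γ) α ρ).Run (store x y R T)
        (store x y (Function.update (Function.update (Function.update R j₀ []) j₁ []) j₂ c) T)
        (3 * (R j₀).length + 1 + (2 * (R j₁).length + 1)) := by
  obtain ⟨v, c, hiff, hv, hc, hrun⟩ :=
    exists_run_loop_compareLetter (ρ := ρ) x y R T h₀₁ h₀₂ h₁₂ rfl
  refine ⟨v.reverse ++ c, ?_, ?_, ?_⟩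
  · rw [List.append_eq_nil_iff, List.reverse_eq_nil_iff, hiff, and_iff_left h₂]
  · grind
  · let R' := Function.update (Function.update (Function.update R j₀ []) j₁ v) j₂ c
    have hR'₁ : R' j₁ = v := by simp [R', h₁₂]
    have hmove := run_move_reg (ρ := ρ) x y R' T h₁₂
    have hend : Function.update (Function.update R' j₁ []) j₂ ((R' j₁).reverse ++ R' j₂) =
        Function.update (Function.update (Function.update R j₀ []) j₁ []) j₂ (v.reverse ++ c) := by
      funext k
      simp only [R', Function.update_apply]
      grind
    rw [hend, hR'₁] at hmove
    exact (hrun.seq hmove).mono (by omega)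

end Compare

section Ite

variable [Finite α] [DecidableEq α] {D₁ D₂ D₃ : Type} {P Q P' : Program (Alphabet I O α Γ) α ρ}
  {L : Layout X n (Fin 3 ⊕ D₁ ⊕ D₂ ⊕ D₃)} {f g h : (Fin n → List α) → List α} {t t' u s : ℕ → ℕ}

theorem Program.Computes.exists_run_compare
    (hP : P.Computes (L.redirect (.inl 0) (.trans .inl .inr) (by simp)) g t)
    (hQ : Q.Computes (L.redirect (.inl 1) (.trans .inl (.trans .inr .inr)) (by simp)) h t')
    (x : List I) (y : List O) (R : X → List α) (T : ∀ k, List (Γ k)) {S : Fin n → List α}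
    {N b : ℕ} (hS : ∀ i, R (L.reg i) = S i) (hD : ∀ j, R (L.aux j) = [])
    (hN : ∀ i, (S i).length ≤ N) (hg : (g S).length ≤ b) (hh : (h S).length ≤ b) :
    ∃ c, (c = [] ↔ g S = h S) ∧ c.length ≤ 2 * b ∧
      (P.seq (Q.seq (compare (L.aux (.inl 0)) (L.aux (.inl 1)) (L.aux (.inl 2))))).Run
        (store x y R T) (store x y (Function.update R (L.aux (.inl 2)) c) T)
        (t N + (t' N + (5 * b + 2))) := by
  have h₀₁ : L.aux (.inl 0) ≠ L.aux (.inl 1) := L.aux.injective.ne (by simp)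
  have h₀₂ : L.aux (.inl 0) ≠ L.aux (.inl 2) := L.aux.injective.ne (by simp)
  have h₁₂ : L.aux (.inl 1) ≠ L.aux (.inl 2) := L.aux.injective.ne (by simp)
  let R₁ := Function.update R (L.aux (.inl 0)) (g S)
  let R₂ := Function.update R₁ (L.aux (.inl 1)) (h S)
  have h₁ : P.Run (store x y R T) (store x y R₁ T) (t N) := by
    simpa [hD] using hP x y R T S N hS (fun i => hD (.inr (.inl i))) hN
  have h₂ : Q.Run (store x y R₁ T) (store x y R₂ T) (t' N) := by
    simpa [hD, R₁, R₂, h₀₁.symm] using hQ x y R₁ T S N (fun i => by simp [R₁, hS, L.reg_ne_aux])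
      (fun i => by simp [R₁, hD]) hN
  obtain ⟨c, hc, hcb, h₃⟩ := QCSPReduction.exists_run_compare (ρ := ρ) x y R₂ T h₀₁ h₀₂ h₁₂
    (by simp [R₁, R₂, h₀₂.symm, h₁₂.symm, hD])
  have hR₂₀ : R₂ (L.aux (.inl 0)) = g S := by simp [R₁, R₂, h₀₁]
  have hR₂₁ : R₂ (L.aux (.inl 1)) = h S := by simp [R₂]
  rw [hR₂₀, hR₂₁] at hc hcb h₃
  have hend : Function.update (Function.update (Function.update R₂ (L.aux (.inl 0)) [])
      (L.aux (.inl 1)) []) (L.aux (.inl 2)) c = Function.update R (L.aux (.inl 2)) c := by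
    funext k
    simp only [R₁, R₂, Function.update_apply]
    grind
  rw [hend] at h₃
  exact ⟨c, hc, by omega, (h₁.seq (h₂.seq h₃)).mono (by omega)⟩

theorem Program.Computes.ite
    (hP : P.Computes (L.redirect (.inl 0) (.trans .inl .inr) (by simp)) g t)
    (hQ : Q.Computes (L.redirect (.inl 1) (.trans .inl (.trans .inr .inr)) (by simp)) h t')
    (hP' : P'.Computes (L.restrict (.trans .inr (.trans .inr .inr))) f u)
    (hs : ∀ S N, (∀ i, (S i).length ≤ N) → (g S).length ≤ s N ∧ (h S).length ≤ s N) :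
    Program.Computes
      (.seq (P.seq (Q.seq (compare (L.aux (.inl 0)) (L.aux (.inl 1)) (L.aux (.inl 2)))))
        (pop (.reg (L.aux (.inl 2))) id fun o =>
          o.elim P' fun _ => clear (.reg (L.aux (.inl 2))) id))
      L (fun S => if g S = h S then f S else [])
      fun N => t N + (t' N + (5 * s N + 2)) + (u N + (4 * s N + 1) + 1) :=
  fun x y R T S N hS hD hN => by
    obtain ⟨c, hc, hcN, hrun⟩ :=
      hP.exists_run_compare hQ x y R T hS hD hN (hs S N hN).1 (hs S N hN).2
    refine hrun.seq (Program.Run.pop ?_)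
    have hstore : store x y (Function.update R (L.aux (.inl 2)) c) T (.reg (L.aux (.inl 2))) = c :=
      Function.update_self ..
    rw [hstore, Loc.update_store_reg, Function.update_idem]
    have hR : Function.update R (L.aux (.inl 2)) [] = R := by rw [Function.update_eq_self_iff, hD]
    dsimp only
    rcases c with _ | ⟨a, c⟩
    · have hf := hP' x y R T S N hS (fun j => hD _) hN
      rw [if_pos (hc.1 rfl), List.tail_nil, hR]
      exact hf.mono (Nat.le_add_right _ _)
    · have hclear := run_clear_reg (ρ := ρ) x y (Function.update R (L.aux (.inl 2)) c) T
        (L.aux (.inl 2))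
      rw [Function.update_self, Function.update_idem, hR] at hclear
      rw [if_neg fun h => absurd (hc.2 h) (List.cons_ne_nil _ _), List.nil_append,
        Function.update_eq_self]
      rw [List.length_cons] at hcN
      exact hclear.mono (by omega)

end Ite

end Computes

/-! ### Polynomial time -/

theorem eval_le_eval (p : Polynomial ℕ) {m n : ℕ} (h : m ≤ n) : p.eval m ≤ p.eval n := by
  simp only [Polynomial.eval_eq_sum_range]
  gcongr

theorem Program.Computes.mono {X I O K α ρ D : Type} [DecidableEq X] [DecidableEq K] {Γ : K → Type}
    {n : ℕ} {P : Program (Loc.Alphabet I O α Γ) α ρ} {L : Layout X n D}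
    {f : (Fin n → List α) → List α} {t t' : ℕ → ℕ} (h : P.Computes L f t) (ht : ∀ N, t N ≤ t' N) :
    P.Computes L f t' :=
  fun x y R T S N hS hD hN => (h x y R T S N hS hD hN).mono (ht N)

/-- The function `f` of `n` words is computed in polynomial time by a program which uses finitely
many auxiliary registers, on every machine which has enough registers. -/
def PolyTime {α : Type} {n : ℕ} (f : (Fin n → List α) → List α) : Prop :=
  ∃ (D : Type) (_ : Finite D) (q : Polynomial ℕ), ∀ {X I O K ρ : Type} [DecidableEq X]
    [DecidableEq K] (Γ : K → Type) (L : Layout X n D),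
      ∃ P : Program (Loc.Alphabet I O α Γ) α ρ, P.Computes L f fun N => q.eval N

namespace PolyTime

open Polynomial (C)

variable {α : Type} {n : ℕ} {f g h : (Fin n → List α) → List α}

theorem exists_length_le (hf : PolyTime f) :
    ∃ s : Polynomial ℕ, ∀ S N, (∀ i, (S i).length ≤ N) → (f S).length ≤ s.eval N := by
  classical
  obtain ⟨D, _, q, hq⟩ := hf
  let L : Layout (Option (Fin n ⊕ D)) n D :=
    { reg i := some (.inl i)
      out := none
      aux := .trans .inr .some
      reg_ne_out := by simp
      reg_ne_aux := by simp
      aux_ne_out := by simp }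
  obtain ⟨P, hP⟩ := hq (I := Empty) (O := Empty) (K := Empty) (ρ := Unit) (fun _ => Empty) L
  have := P.finite_label
  obtain ⟨b, hb⟩ := exists_length_le_of_steps P.code
  refine ⟨C b * q, fun S N hN => ?_⟩
  obtain ⟨v, m, hm, hsteps⟩ := hP [] [] (fun j => j.elim [] (Sum.elim S fun _ => [])) (fun _ => [])
    S N (fun _ => rfl) (fun _ => rfl) hN (none, ())
  have hlen := hb _ _ _ hsteps (.reg none)
  simp only [Loc.store, L, Option.elim_none, List.append_nil, Function.update_self,
    List.length_nil, zero_add] at hlen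
  rw [Polynomial.eval_mul, Polynomial.eval_C]
  exact hlen.trans (Nat.mul_le_mul_left b hm)

theorem reg [Finite α] (i : Fin n) : PolyTime fun S : Fin n → List α => S i :=
  ⟨Unit, inferInstance, C 5 * .X + C 2, fun _ L =>
    ⟨_, (computes_reg L i).mono fun N => by simp⟩⟩

theorem nil : PolyTime fun _ : Fin n → List α => [] :=
  ⟨Empty, inferInstance, C 1, fun _ L => ⟨_, (computes_skip L).mono fun N => by simp⟩⟩

theorem cons (hf : PolyTime f) (a : α) : PolyTime fun S => a :: f S := by
  obtain ⟨D, hD, q, hq⟩ := hf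
  refine ⟨D, hD, q + C 1, fun Γ L => ?_⟩
  obtain ⟨P, hP⟩ := hq Γ L
  exact ⟨_, (hP.cons a).mono fun N => by simp⟩

theorem append (hf : PolyTime f) (hg : PolyTime g) : PolyTime fun S => f S ++ g S := by
  obtain ⟨D, _, q, hq⟩ := hf
  obtain ⟨D', _, q', hq'⟩ := hg
  refine ⟨D ⊕ D', inferInstance, q' + q, fun Γ L => ?_⟩
  obtain ⟨P, hP⟩ := hq Γ (L.restrict .inl)
  obtain ⟨Q, hQ⟩ := hq' Γ (L.restrict .inr)
  exact ⟨_, (hP.append hQ).mono fun N => by simp⟩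

theorem rename {m : ℕ} {f : (Fin m → List α) → List α} (hf : PolyTime f) (e : Fin m → Fin n) :
    PolyTime fun S => f (S ∘ e) := by
  obtain ⟨D, hD, q, hq⟩ := hf
  refine ⟨D, hD, q, fun Γ L => ?_⟩
  obtain ⟨P, hP⟩ := hq Γ (L.rename e)
  exact ⟨P, hP.rename⟩

theorem scan [Finite α] {F : List α → α → (Fin n → List α) → List α} (hg : PolyTime g)
    (hF : ∀ a, PolyTime fun S : Fin (n + 1) → List α => F (S 0) a (Fin.tail S)) :
    PolyTime fun S => scan (fun p a => F p a S) [] (g S) := by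
  have := Fintype.ofFinite α
  obtain ⟨s, hs⟩ := hg.exists_length_le
  obtain ⟨D, _, q, hq⟩ := hg
  choose D' _ u hu using hF
  obtain ⟨v, hv⟩ : ∃ v : Polynomial ℕ, ∀ a N, (u a).eval N ≤ v.eval N :=
    ⟨∑ a, u a, fun a N => by
      rw [Polynomial.eval_finsetSum]
      exact Finset.single_le_sum_of_canonicallyOrdered (f := fun a => (u a).eval N)
        (Finset.mem_univ a)⟩
  refine ⟨Bool ⊕ D ⊕ Σ a, D' a, inferInstance,
    (q + (C 2 * s + C 1)) + ((v.comp (.X + s) + C 1) * s + C 1), fun Γ L => ?_⟩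
  obtain ⟨P, hP⟩ := hq Γ (L.redirect (.inl false) (.trans .inl .inr) (by simp))
  choose Q hQ using fun a => hu a Γ
    (L.bind (.inl true) (.trans (.sigmaMk a) (.trans .inr .inr)) (by simp))
  refine ⟨_, (hP.scan (fun a => (hQ a).mono (hv a)) hs).mono fun N => ?_⟩
  simp

theorem ite [Finite α] [DecidableEq α] (hg : PolyTime g) (hh : PolyTime h) (hf : PolyTime f) :
    PolyTime fun S => if g S = h S then f S else [] := by
  obtain ⟨s, hs⟩ := hg.exists_length_le
  obtain ⟨s', hs'⟩ := hh.exists_length_le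
  obtain ⟨D₁, _, t, ht⟩ := hg
  obtain ⟨D₂, _, t', ht'⟩ := hh
  obtain ⟨D₃, _, u, hu⟩ := hf
  refine ⟨Fin 3 ⊕ D₁ ⊕ D₂ ⊕ D₃, inferInstance,
    t + (t' + (C 5 * (s + s') + C 2)) + (u + (C 4 * (s + s') + C 1) + C 1), fun Γ L => ?_⟩
  obtain ⟨P, hP⟩ := ht Γ (L.redirect (.inl 0) (.trans .inl .inr) (by simp))
  obtain ⟨Q, hQ⟩ := ht' Γ (L.redirect (.inl 1) (.trans .inl (.trans .inr .inr)) (by simp))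
  obtain ⟨P', hP'⟩ := hu Γ (L.restrict (.trans .inr (.trans .inr .inr)))
  refine ⟨_, (hP.ite hQ hP' (s := fun N => s.eval N + s'.eval N) fun S N hN =>
    ⟨(hs S N hN).trans (Nat.le_add_right _ _), (hs' S N hN).trans (Nat.le_add_left _ _)⟩).mono
      fun N => ?_⟩
  simp

theorem flatMap [Finite α] {F : α → (Fin n → List α) → List α} (hg : PolyTime g)
    (hF : ∀ a, PolyTime (F a)) : PolyTime fun S => (g S).flatMap fun a => F a S := by
  have hscan (S : Fin n → List α) (w p : List α) :
      QCSPReduction.scan (fun _ a => F a S) p w = w.flatMap fun a => F a S := by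
    induction w generalizing p with
    | nil => rfl
    | cons a w ih => rw [QCSPReduction.scan, ih, List.flatMap_cons]
  simp only [← hscan _ _ []]
  exact hg.scan fun a => (hF a).rename Fin.succ

end PolyTime

/-! ### Machines with a subroutine -/

section Subroutine

open Loc (Alphabet store)
open Program (move clear call)

/-- The registers of a machine which calls a subroutine: two words, an output, a buffer, and
auxiliary registers for preparing the call and for processing its result. -/
abbrev MainReg (D D' : Type) : Type := Fin 4 ⊕ D ⊕ D'

namespace MainReg

variable {D D' α : Type}

/-- The contents of the registers: the buffer and the auxiliary registers are empty. -/
def contents (x w v : List α) : MainReg D D' → List α :=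
  Sum.elim ![x, w, v, []] fun _ => []

/-- The registers for preparing the call. -/
def preLayout : Layout (MainReg D D') 1 D where
  reg _ := .inl 0
  out := .inl 2
  aux := .trans .inl .inr
  reg_ne_out := by simp
  reg_ne_aux := by simp
  aux_ne_out := by simp

/-- The registers for processing the result. -/
def postLayout : Layout (MainReg D D') 2 D' where
  reg := ![.inl 0, .inl 1]
  out := .inl 2
  aux := .trans .inr .inr
  reg_ne_out := by simp [Fin.forall_fin_two]
  reg_ne_aux := by simp [Fin.forall_fin_two]
  aux_ne_out := by simp

theorem contents_nil : contents [] [] [] = fun _ : MainReg D D' => ([] : List α) := by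
  funext j
  rcases j with j | j
  · fin_cases j <;> rfl
  · rfl

theorem contents_inl (x w v : List α) (i : Fin 4) :
    contents (D := D) (D' := D') x w v (.inl i) = ![x, w, v, []] i := rfl

variable [DecidableEq (MainReg D D')] (x w v u : List α)

@[simp]
theorem update_contents_zero :
    Function.update (contents (D := D) (D' := D') x w v) (.inl 0) u = contents u w v := by
  funext j
  rcases j with j | j
  · fin_cases j <;> simp [contents]
  · simp [contents]

@[simp]
theorem update_contents_one :
    Function.update (contents (D := D) (D' := D') x w v) (.inl 1) u = contents x u v := by
  funext j
  rcases j with j | j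
  · fin_cases j <;> simp [contents]
  · simp [contents]

@[simp]
theorem update_contents_two :
    Function.update (contents (D := D) (D' := D') x w v) (.inl 2) u = contents x w u := by
  funext j
  rcases j with j | j
  · fin_cases j <;> simp [contents]
  · simp [contents]

end MainReg

open MainReg

variable {X I O K Λ α ρ D D' : Type} [DecidableEq X] [DecidableEq (MainReg D D')] [DecidableEq K]
  {Γ : K → Type}

/-- Move a word from the stack `k` onto the stack `k'`, keeping the order of the letters, by way of
the register `j`. -/
def transfer [Finite α] (k : Loc X K) (j : X) (k' : Loc X K) (g : Alphabet I O α Γ k → α)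
    (g' : α → Alphabet I O α Γ k') : Program (Alphabet (X := X) I O α Γ) α ρ :=
  .seq (move k (.reg j) g id) (move (.reg j) k' id g')

theorem run_transfer [Finite α] {k k' : Loc X K} {j : X} (hk : k ≠ .reg j) (hk' : k' ≠ .reg j)
    (hkk' : k ≠ k') (g : Alphabet I O α Γ k → α) (g' : α → Alphabet I O α Γ k')
    (S : ∀ k, List (Alphabet I O α Γ k)) (hj : S (.reg j) = []) :
    (transfer k j k' g g' : Program (Alphabet I O α Γ) α ρ).Run S
      (Function.update (Function.update S k []) k' ((S k).map (g' ∘ g) ++ S k'))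
      (4 * (S k).length + 2) := by
  have h₁ := Program.run_move (α := α) (ρ := ρ) hk g id S
  have h₂ := Program.run_move (α := α) (ρ := ρ) hk'.symm id g' (Function.update
    (Function.update S k []) (.reg j) ((S k).reverse.map (id ∘ g) ++ S (.reg j)))
  have hend : Function.update (Function.update S k []) (.reg j) [] = Function.update S k [] := by
    rw [← hj, ← Function.update_of_ne hk.symm [] S, Function.update_eq_self]
  refine (h₁.seq ?_).mono (t := (2 * (S k).length + 1) + (2 * (S k).length + 1)) (by omega)
  simpa [hj, hend, hkk'.symm, hk'] using h₂

section Transfer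

variable [Finite α] (x : List I) (y : List O) (a c v : List α) (T : ∀ k, List (Γ k))

theorem run_transfer_input (ι : I → α) :
    (transfer .input (.inl 3) (.reg (.inl 0)) ι id :
        Program (Alphabet (X := MainReg D D') I O α Γ) α ρ).Run
      (store x y (contents [] c v) T) (store [] y (contents (x.map ι) c v) T)
      (4 * x.length + 2) := by
  simpa [store, contents_inl] using run_transfer (X := MainReg D D') (α := α) (ρ := ρ) (Γ := Γ)
    (k := .input) (k' := .reg (.inl 0)) (j := .inl 3) (by simp) (by simp) (by simp) ι id
    (store x y (contents [] c v) T) rfl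

theorem run_transfer_output (o : α → O) :
    (transfer (.reg (.inl 2)) (.inl 3) .output id o :
        Program (Alphabet (X := MainReg D D') I O α Γ) α ρ).Run
      (store x [] (contents a c v) T) (store x (v.map o) (contents a c []) T)
      (4 * v.length + 2) := by
  simpa [store, contents_inl] using run_transfer (X := MainReg D D') (α := α) (ρ := ρ) (Γ := Γ)
    (k := .reg (.inl 2)) (k' := .output) (j := .inl 3) (by simp) (by simp) (by simp) id o
    (store x [] (contents a c v) T) rfl

theorem run_transfer_to_sub (k : K) (σ : α → Γ k) :
    (transfer (.reg (.inl 2)) (.inl 3) (.sub k) id σ :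
        Program (Alphabet (X := MainReg D D') I O α Γ) α ρ).Run
      (store x y (contents a c v) fun _ => [])
      (store x y (contents a c []) (Function.update (fun _ => []) k (v.map σ)))
      (4 * v.length + 2) := by
  simpa [store, contents_inl] using run_transfer (X := MainReg D D') (α := α) (ρ := ρ) (Γ := Γ)
    (k := .reg (.inl 2)) (k' := .sub k) (j := .inl 3) (by simp) (by simp) (by simp) id σ
    (store x y (contents a c v) fun _ => []) rfl

theorem run_transfer_from_sub (k : K) (κ : Γ k → α) (w : List (Γ k)) :
    (transfer (.sub k) (.inl 3) (.reg (.inl 1)) κ id :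
        Program (Alphabet (X := MainReg D D') I O α Γ) α ρ).Run
      (store x y (contents a [] v) (Function.update (fun _ => []) k w))
      (store x y (contents a (w.map κ) v) fun _ => [])
      (4 * w.length + 2) := by
  simpa [store, contents_inl] using run_transfer (X := MainReg D D') (α := α) (ρ := ρ) (Γ := Γ)
    (k := .sub k) (k' := .reg (.inl 1)) (j := .inl 3) (by simp) (by simp) (by simp) κ id
    (store x y (contents a [] v) (Function.update (fun _ => []) k w)) rfl

end Transfer

/-- A program which computes the input of a subroutine, calls the subroutine and computes the
output from the input and the result of the call. -/
def wrap [Finite α] [Finite Λ] (P Q : Program (Alphabet (X := MainReg D D') I O α Γ) α ρ)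
    (k₀ k₁ : K) (main : Λ) (init : ρ) (M : Λ → TM2.Stmt Γ Λ ρ) (ι : I → α) (σ : α → Γ k₀)
    (κ : Γ k₁ → α) (o : α → O) : Program (Alphabet (X := MainReg D D') I O α Γ) α ρ :=
  .seq (transfer .input (.inl 3) (.reg (.inl 0)) ι id) <| .seq P <|
  .seq (transfer (.reg (.inl 2)) (.inl 3) (.sub k₀) id σ) <| .seq (call main init M) <|
  .seq (transfer (.sub k₁) (.inl 3) (.reg (.inl 1)) κ id) <| .seq Q <|
  .seq (transfer (.reg (.inl 2)) (.inl 3) .output id o) <|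
  .seq (clear (.reg (.inl 0)) id) (clear (.reg (.inl 1)) id)

theorem run_wrap [Finite α] [Finite Λ] {P Q : Program (Alphabet I O α Γ) α ρ}
    {pre : (Fin 1 → List α) → List α} {post : (Fin 2 → List α) → List α} {t t' : ℕ → ℕ}
    (hP : P.Computes (preLayout (D := D) (D' := D')) pre t) (hQ : Q.Computes postLayout post t')
    {k₀ k₁ : K} {main : Λ} {init v' : ρ} {M : Λ → TM2.Stmt Γ Λ ρ} {ι : I → α} {σ : α → Γ k₀}
    {κ : Γ k₁ → α} {o : α → O} {x : List I} {w : List (Γ k₁)} {n N : ℕ}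
    (h : Steps M n
      ⟨some main, init, Function.update (fun _ => []) k₀ ((pre ![x.map ι]).map σ)⟩
      ⟨none, v', Function.update (fun _ => []) k₁ w⟩)
    (hx : x.length ≤ N) (hn : n ≤ N) (hw : w.length ≤ N) (hpre : (pre ![x.map ι]).length ≤ N)
    (hpost : (post ![x.map ι, w.map κ]).length ≤ N) :
    (wrap P Q k₀ k₁ main init M ι σ κ o).Run (store x [] (contents [] [] []) fun _ => [])
      (store [] ((post ![x.map ι, w.map κ]).map o) (contents [] [] []) fun _ => [])
      (t N + t' N + 21 * N + 11) := by
  set a := x.map ι with ha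
  set b := pre ![a] with hb
  set c := w.map κ with hc
  set d := post ![a, c] with hd
  have hrunP := hP [] [] (contents a [] []) (fun _ => []) ![a] N
    (by simp [preLayout, contents]) (by simp [preLayout, contents]) (by simpa [ha] using hx)
  have hrunQ := hQ [] [] (contents a c []) (fun _ => []) ![a, c] N
    (by simp [postLayout, contents, Fin.forall_fin_two]) (by simp [postLayout, contents])
    (by simpa [ha, hc, Fin.forall_fin_two] using ⟨hx, hw⟩)
  have hclear₀ := run_clear_reg (X := MainReg D D') (I := I) (O := O) (ρ := ρ) [] (d.map o)
    (contents a c []) (Γ := Γ) (fun _ => []) (.inl 0)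
  have hclear₁ := run_clear_reg (X := MainReg D D') (I := I) (O := O) (ρ := ρ) [] (d.map o)
    (contents [] c []) (Γ := Γ) (fun _ => []) (.inl 1)
  simp only [preLayout, postLayout, update_contents_zero, update_contents_one,
    update_contents_two, contents_inl, Matrix.cons_val, List.append_nil, ← hb, ← hd]
    at hrunP hrunQ hclear₀ hclear₁
  refine ((run_transfer_input x [] [] [] (fun _ => []) ι).seq <| hrunP.seq <|
    (run_transfer_to_sub [] [] a [] b k₀ σ).seq <|
    (Program.run_call [] [] (contents a [] []) h).seq <|
    (run_transfer_from_sub [] [] a [] k₁ κ w).seq <| hrunQ.seq <|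
    (run_transfer_output [] a c d (fun _ => []) o).seq <| hclear₀.seq hclear₁).mono ?_
  simp only [ha, hc, List.length_map]
  omega

end Subroutine

section Outputs

open Turing (FinTM2 TM2ComputableAux TM2ComputableInPolyTime TM2OutputsInTime initList haltList)

theorem initList_eq_update (tm : FinTM2) (s : List (tm.Γ tm.k₀)) :
    initList tm s = ⟨some tm.main, tm.initialState, Function.update (fun _ => []) tm.k₀ s⟩ := by
  unfold initList
  congr 1
  funext k
  rcases eq_or_ne k tm.k₀ with rfl | h
  · simp
  · simp [h]

theorem haltList_eq_update (tm : FinTM2) (s : List (tm.Γ tm.k₁)) :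
    haltList tm s = ⟨none, tm.initialState, Function.update (fun _ => []) tm.k₁ s⟩ := by
  unfold haltList
  congr 1
  funext k
  rcases eq_or_ne k tm.k₁ with rfl | h
  · simp
  · simp [h]

theorem nonempty_outputsInTime_iff {tm : FinTM2} {l : List (tm.Γ tm.k₀)}
    {l' : List (tm.Γ tm.k₁)} {t : ℕ} :
    Nonempty (TM2OutputsInTime tm l (some l') t) ↔ ∃ n ≤ t, Steps tm.m n
      ⟨some tm.main, tm.initialState, Function.update (fun _ => []) tm.k₀ l⟩
      ⟨none, tm.initialState, Function.update (fun _ => []) tm.k₁ l'⟩ := by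
  rw [← initList_eq_update, ← haltList_eq_update]
  exact ⟨fun ⟨⟨n, h⟩, hn⟩ => ⟨n, hn, steps_iff_iterate.2 h⟩,
    fun ⟨n, hn, h⟩ => ⟨⟨n, steps_iff_iterate.1 h⟩, hn⟩⟩

theorem exists_length_le_of_outputsInTime (tm : FinTM2) :
    ∃ b, ∀ l l' t, Nonempty (TM2OutputsInTime tm l (some l') t) →
      l'.length ≤ l.length + b * t := by
  have := tm.ΛFin
  obtain ⟨b, hb⟩ := exists_length_le_of_steps tm.m
  refine ⟨b, fun l l' t h => ?_⟩
  obtain ⟨n, hn, h⟩ := nonempty_outputsInTime_iff.1 h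
  have hl' := hb _ _ _ h tm.k₁
  have hl : (Function.update (fun _ => []) tm.k₀ l tm.k₁).length ≤ l.length := by
    rcases eq_or_ne tm.k₁ tm.k₀ with h' | h'
    · rw [h', Function.update_self]
    · simp [h']
  simp only [Function.update_self] at hl'
  exact hl'.trans (Nat.add_le_add hl (Nat.mul_le_mul_left b hn))

namespace Program

variable {K α ρ : Type} [DecidableEq K] [Fintype K] {Γ : K → Type} [Fintype α] [Fintype ρ]

/-- Halt in the given internal state, as machines are required to do. -/
def reset (v : Option α × ρ) : Program Γ α ρ :=
  ⟨Unit, inferInstance, (), fun _ => .load (fun _ => v) .halt⟩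

/-- The machine which runs a program. -/
noncomputable def toFinTM2 (P : Program Γ α ρ) (k₀ k₁ : K) [Fintype (Γ k₀)] (v : Option α × ρ) :
    FinTM2 where
  K := K
  k₀ := k₀
  k₁ := k₁
  Γ := Γ
  Λ := (P.seq (reset v)).Label
  main := (P.seq (reset v)).main
  ΛFin := have := (P.seq (reset v)).finite_label; Fintype.ofFinite _
  σ := Option α × ρ
  initialState := v
  m := (P.seq (reset v)).code

theorem Run.nonempty_outputsInTime {P : Program Γ α ρ} {k₀ k₁ : K} [Fintype (Γ k₀)]
    (v : Option α × ρ) {x : List (Γ k₀)} {y : List (Γ k₁)} {t : ℕ}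
    (h : P.Run (Function.update (fun _ => []) k₀ x) (Function.update (fun _ => []) k₁ y) t) :
    Nonempty (TM2OutputsInTime (P.toFinTM2 k₀ k₁ v) x (some y) (t + 1)) := by
  obtain ⟨v', n, hn, h⟩ := h v
  have h₁ := h.relabel (M' := (P.seq (reset v)).code) .inl (some (.inr ())) fun _ => rfl
  exact nonempty_outputsInTime_iff.2
    ⟨n + 1, Nat.succ_le_succ hn, h₁.trans (.head rfl (.refl _))⟩

end Program

variable {α A B I O : Type} [Finite α] {pre : (Fin 1 → List α) → List α}
  {post : (Fin 2 → List α) → List α}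

theorem exists_run_wrap (M : TM2ComputableAux A B) (σ : α → A) (κ : B → α) (ι : I → α)
    (o : α → O) (hpre : PolyTime pre) (hpost : PolyTime post) (p : Polynomial ℕ) :
    ∃ (D : Type) (_ : Fintype D) (_ : DecidableEq D)
      (P : Program (Loc.Alphabet (X := D) I O α M.tm.Γ) α M.tm.σ) (q : Polynomial ℕ),
      ∀ (x : List I) (w : List B),
        Nonempty (TM2OutputsInTime M.tm (((pre ![x.map ι]).map σ).map M.inputAlphabet.invFun)
          (some (w.map M.outputAlphabet.invFun)) (p.eval x.length)) →
        P.Run (Loc.store x [] (fun _ => []) fun _ => [])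
          (Loc.store [] ((post ![x.map ι, w.map κ]).map o) (fun _ => []) fun _ => [])
          (q.eval x.length) := by
  classical
  obtain ⟨s, hs⟩ := hpre.exists_length_le
  obtain ⟨s', hs'⟩ := hpost.exists_length_le
  obtain ⟨D, _, t, ht⟩ := hpre
  obtain ⟨D', _, t', ht'⟩ := hpost
  have := M.tm.ΛFin
  obtain ⟨b, hb⟩ := exists_length_le_of_outputsInTime M.tm
  obtain ⟨P, hP⟩ := ht M.tm.Γ (I := I) (O := O) (ρ := M.tm.σ) (MainReg.preLayout (D' := D'))
  obtain ⟨Q, hQ⟩ := ht' M.tm.Γ (I := I) (O := O) (ρ := M.tm.σ) (MainReg.postLayout (D := D))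
  let W : Polynomial ℕ := .X + s + p + .C b * p
  let N : Polynomial ℕ := W + s'.comp W
  refine ⟨MainReg D D', Fintype.ofFinite _, inferInstance,
    wrap P Q M.tm.k₀ M.tm.k₁ M.tm.main M.tm.initialState M.tm.m ι (M.inputAlphabet.invFun ∘ σ)
      (κ ∘ M.outputAlphabet) o, t.comp N + t'.comp N + 21 * N + 11, fun x w h => ?_⟩
  have hquestion := hs ![x.map ι] x.length (by simp)
  have hanswer := hb _ _ _ h
  simp only [List.length_map] at hanswer
  have hW : W.eval x.length =
      x.length + s.eval x.length + p.eval x.length + b * p.eval x.length := by simp [W]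
  have hN : N.eval x.length = W.eval x.length + s'.eval (W.eval x.length) := by simp [N]
  have hpost := hs' ![x.map ι, w.map κ] (W.eval x.length) (by
    simp only [Fin.forall_fin_two, Matrix.cons_val, List.length_map]; omega)
  obtain ⟨n, hn, h⟩ := nonempty_outputsInTime_iff.1 h
  rw [List.map_map] at h
  have hκ : (w.map M.outputAlphabet.invFun).map (κ ∘ M.outputAlphabet) = w.map κ := by simp
  have hrun := run_wrap hP hQ (κ := κ ∘ M.outputAlphabet) (o := o) (N := N.eval x.length) h
    (by omega) (by omega) (by rw [List.length_map]; omega) (by omega) (by rw [hκ]; omega)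
  rw [hκ, MainReg.contents_nil] at hrun
  simpa using hrun

theorem nonempty_tm2ComputableInPolyTime_of_subroutine [Finite I] {β β' : Type} {ea : β → List I}
    {eb : β' → List O} {f : β → β'} (M : TM2ComputableAux A B) (σ : α → A) (κ : B → α)
    (ι : I → α) (o : α → O) (hpre : PolyTime pre) (hpost : PolyTime post) (p : Polynomial ℕ)
    (h : ∀ b, ∃ w : List B, Nonempty (TM2OutputsInTime M.tm
        (((pre ![(ea b).map ι]).map σ).map M.inputAlphabet.invFun)
        (some (w.map M.outputAlphabet.invFun)) (p.eval (ea b).length)) ∧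
      (post ![(ea b).map ι, w.map κ]).map o = eb (f b)) :
    Nonempty (TM2ComputableInPolyTime ea eb f) := by
  have := Fintype.ofFinite α
  have := Fintype.ofFinite I
  obtain ⟨D, _, _, P, q, hP⟩ := exists_run_wrap M σ κ ι o hpre hpost p
  have := M.tm.kFin
  have := M.tm.σFin
  have : Fintype (Loc.Alphabet (X := D) I O α M.tm.Γ .input) := ‹Fintype I›
  have houtputs (b : β) {x : List I} {y : List O} (hx : x = ea b) (hy : y = eb (f b)) :
      Nonempty (TM2OutputsInTime (P.toFinTM2 .input .output (none, M.tm.initialState)) x (some y)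
        ((q + 1).eval (ea b).length)) := by
    obtain ⟨w, hw, hpost⟩ := h b
    have hrun := hP _ _ hw
    rw [hpost, ← hx, ← hy, ← Loc.update_store_input [] x, ← Loc.update_store_output [] [] y,
      Loc.store_nil] at hrun
    rw [Polynomial.eval_add, Polynomial.eval_one, ← hx]
    exact hrun.nonempty_outputsInTime (none, M.tm.initialState)
  exact ⟨{
    tm := P.toFinTM2 .input .output (none, M.tm.initialState)
    inputAlphabet := Equiv.refl I
    outputAlphabet := Equiv.refl O
    time := q + 1
    outputsFun b := (houtputs b (List.map_id _) (List.map_id _)).some }⟩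

end Outputs

/-! ### Words of the reduction -/

section Letter

open scoped FirstOrder

variable {L L' : FirstOrder.Language.{0, 0}} {A : Type}

instance Sym.instFinite [Finite (Σ k, L.Relations k)] [Finite L.Constants] : Finite (Sym L) := by
  let f : Sym L → Quantifier ⊕ (Σ k, L.Relations k) ⊕ L.Constants ⊕ Fin 3
    | .quant q => .inl q
    | .rel k r => .inr (.inl ⟨k, r⟩)
    | .const c => .inr (.inr (.inl c))
    | .eq => .inr (.inr (.inr 0))
    | .var => .inr (.inr (.inr 1))
    | .tick => .inr (.inr (.inr 2))
  have : Finite Quantifier :=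
    .of_surjective (fun b : Bool => if b then .all else .ex) fun
      | .all => ⟨true, rfl⟩
      | .ex => ⟨false, rfl⟩
  refine Finite.of_injective f fun a b => ?_
  cases a <;> cases b <;> simp +contextual [f]

instance AdvSym.instFinite [Finite A] : Finite (AdvSym A) := by
  let f : AdvSym A → Option (Option A)
    | .elem a => some (some a)
    | .tupleEnd => some none
    | .advEnd => none
  refine Finite.of_injective f fun a b => ?_
  cases a <;> cases b <;> simp [f]

/-- The letters used by the reduction: those of its input, of its output, and of the adversaries
which it asks for. -/
inductive Letter (L L' : FirstOrder.Language.{0, 0}) (A : Type) : Type where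
  | source (s : Sym L)
  | target (s : Sym L')
  | adversary (s : AdvSym A)

noncomputable instance Letter.instDecidableEq : DecidableEq (Letter L L' A) := Classical.decEq _

instance Letter.instFinite [Finite (Sym L)] [Finite (Sym L')] [Finite A] :
    Finite (Letter L L' A) := by
  let f : Letter L L' A → Sym L ⊕ Sym L' ⊕ AdvSym A
    | .source s => .inl s
    | .target s => .inr (.inl s)
    | .adversary s => .inr (.inr s)
  refine Finite.of_injective f fun a b => ?_
  cases a <;> cases b <;> simp [f]

end Letter

section Words

open scoped FirstOrder

variable {L L' : FirstOrder.Language.{0, 0}} {A : Type}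

/-- The length of a word in unary. -/
def tally (w : List (Letter L L' A)) : List (Letter L L' A) :=
  w.flatMap fun _ => [.target .tick]

/-- The quantifiers in the word of a sentence. -/
def quantifierWord (x : List (Letter L L' A)) : List (Letter L L' A) :=
  x.flatMap fun
    | .source (.quant q) => [.source (.quant q)]
    | _ => []

/-- The number of tuples which are completed in a word of adversaries, in unary. -/
def rowCount (w : List (Letter L L' A)) : List (Letter L L' A) :=
  w.flatMap fun
    | .adversary .tupleEnd => [.target .tick]
    | _ => []

/-- The elements of the tuple which is being read, last element first, when `p` is the reverse of
the word of adversaries read so far. -/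
def rowPrefix (p : List (Letter L L' A)) : List (Letter L L' A) :=
  scan (fun p' c => match c with
    | .adversary (.elem a) => if rowCount p' = [] then [.adversary (.elem a)] else []
    | _ => []) [] p

/-- The index, in unary, of the first of the variables which belong to row `r`: each row has one
variable for each quantifier of the sentence `x`. -/
def rowOffset (x r : List (Letter L L' A)) : List (Letter L L' A) :=
  r.flatMap fun _ => tally (quantifierWord x)

/-- The word of the variable of row `r` whose column is the length of `u`. -/
def variableWord (x r u : List (Letter L L' A)) : List (Letter L L' A) :=
  .target .var :: (rowOffset x r ++ tally u)

/-- The transcription of a symbol which shifts the variables by the number written in unary as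
`o`. -/
def shiftLetter (φ : L →ᴸ L') (o : List (Letter L L' A)) :
    Letter L L' A → List (Letter L L' A)
  | .source (.rel k r) => [.target (.rel k (φ.onRelation r))]
  | .source .eq => [.target .eq]
  | .source (.const c) => [.target (.const (φ.onFunction c))]
  | .source .var => .target .var :: o
  | .source .tick => [.target .tick]
  | _ => []

/-- The equations between the existential variable in row `r` and the variables in the same column
of the rows, listed in `w`, which begin in the same way. -/
noncomputable def identificationWord (x w r u : List (Letter L L' A)) : List (Letter L L' A) :=
  scan (fun p c => match c with
    | .adversary (.elem _) =>
      if rowPrefix p = u then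
        .target .eq :: (variableWord x r u ++ variableWord x (rowCount p) u)
      else []
    | _ => []) [] w

/-- The equations for the variable of row `r` in the column of the element `a`, which comes after
the elements `u` of the row. -/
noncomputable def cellWord (name : A → L'.Constants) (x w r u : List (Letter L L' A)) (a : A) :
    List (Letter L L' A) :=
  scan (fun p c => if tally p = tally u then match c with
      | .source (.quant .all) =>
        .target .eq :: (variableWord x r u ++ [.target (.const (name a))])
      | .source (.quant .ex) => identificationWord x w r u
      | _ => []
    else []) [] (quantifierWord x)

/-- The atoms which are written when the symbol after the elements `u` of row `r` is read. -/
noncomputable def rowWord (φ : L →ᴸ L') (name : A → L'.Constants) (x w r u : List (Letter L L' A)) :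
    Letter L L' A → List (Letter L L' A)
  | .adversary (.elem a) => cellWord name x w r u a
  | .adversary .tupleEnd => x.flatMap (shiftLetter φ (rowOffset x r))
  | _ => []

/-- The word of the sentence to which the sentence `x` is reduced, by means of the adversaries
`w`. -/
noncomputable def reductionWord (φ : L →ᴸ L') (name : A → L'.Constants)
    (x w : List (Letter L L' A)) : List (Letter L L' A) :=
  (rowCount w).flatMap (fun _ => (quantifierWord x).flatMap fun _ => [.target (.quant .ex)]) ++
    scan (fun p c => rowWord φ name x w (rowCount p) (rowPrefix p) c) [] w

/-- The question for the adversaries: the length of the quantifier prefix plus one, in unary. -/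
def questionWord (x : List (Letter L L' A)) : List (Letter L L' A) :=
  .target .tick :: tally (quantifierWord x)

end Words

namespace PolyTime

open scoped FirstOrder

variable {L L' : FirstOrder.Language.{0, 0}} {A : Type} {n : ℕ}
  {f x w r u : (Fin n → List (Letter L L' A)) → List (Letter L L' A)}

theorem shiftLetter (φ : L →ᴸ L') (hf : PolyTime f) :
    ∀ c, PolyTime fun S => shiftLetter φ (f S) c
  | .source (.rel _ _) | .source .eq | .source (.const _) | .source .tick => nil.cons _
  | .source .var => hf.cons _
  | .source (.quant _) | .target _ | .adversary _ => nil

variable [Finite (Letter L L' A)]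

theorem tally (hf : PolyTime f) : PolyTime fun S => tally (f S) :=
  hf.flatMap fun _ => nil.cons _

theorem quantifierWord (hx : PolyTime x) : PolyTime fun S => quantifierWord (x S) :=
  hx.flatMap fun
    | .source (.quant _) => nil.cons _
    | .source (.rel _ _) | .source .eq | .source (.const _) | .source .var | .source .tick
    | .target _ | .adversary _ => nil

theorem rowCount (hw : PolyTime w) : PolyTime fun S => rowCount (w S) :=
  hw.flatMap fun
    | .adversary .tupleEnd => nil.cons _
    | .adversary (.elem _) | .adversary .advEnd | .source _ | .target _ => nil

theorem rowPrefix (hf : PolyTime f) : PolyTime fun S => rowPrefix (f S) :=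
  hf.scan fun
    | .adversary (.elem _) => (reg 0).rowCount.ite nil (nil.cons _)
    | .adversary .tupleEnd | .adversary .advEnd | .source _ | .target _ => nil

theorem rowOffset (hx : PolyTime x) (hr : PolyTime r) :
    PolyTime fun S => rowOffset (x S) (r S) :=
  hr.flatMap fun _ => hx.quantifierWord.tally

theorem variableWord (hx : PolyTime x) (hr : PolyTime r) (hu : PolyTime u) :
    PolyTime fun S => variableWord (x S) (r S) (u S) :=
  ((hx.rowOffset hr).append hu.tally).cons _

theorem identificationWord (hx : PolyTime x) (hw : PolyTime w) (hr : PolyTime r)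
    (hu : PolyTime u) : PolyTime fun S => identificationWord (x S) (w S) (r S) (u S) :=
  have hx' := hx.rename Fin.succ
  have hu' := hu.rename Fin.succ
  hw.scan fun
    | .adversary (.elem _) =>
      (reg 0).rowPrefix.ite hu' (((hx'.variableWord (hr.rename Fin.succ) hu').append
        (hx'.variableWord (reg 0).rowCount hu')).cons _)
    | .adversary .tupleEnd | .adversary .advEnd | .source _ | .target _ => nil

theorem cellWord (name : A → L'.Constants) (hx : PolyTime x) (hw : PolyTime w)
    (hr : PolyTime r) (hu : PolyTime u) (a : A) :
    PolyTime fun S => cellWord name (x S) (w S) (r S) (u S) a :=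
  hx.quantifierWord.scan fun c => (reg 0).tally.ite (hu.rename Fin.succ).tally <| match c with
    | .source (.quant .all) =>
      (((hx.variableWord hr hu).rename Fin.succ).append (nil.cons _)).cons _
    | .source (.quant .ex) => (hx.identificationWord hw hr hu).rename Fin.succ
    | .source (.rel _ _) | .source .eq | .source (.const _) | .source .var | .source .tick
    | .target _ | .adversary _ => nil

theorem rowWord (φ : L →ᴸ L') (name : A → L'.Constants) (hx : PolyTime x) (hw : PolyTime w)
    (hr : PolyTime r) (hu : PolyTime u) :
    ∀ c, PolyTime fun S => rowWord φ name (x S) (w S) (r S) (u S) c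
  | .adversary (.elem a) => hx.cellWord name hw hr hu a
  | .adversary .tupleEnd => hx.flatMap ((hx.rowOffset hr).shiftLetter φ)
  | .adversary .advEnd | .source _ | .target _ => nil

theorem reductionWord (φ : L →ᴸ L') (name : A → L'.Constants) (hx : PolyTime x)
    (hw : PolyTime w) : PolyTime fun S => reductionWord φ name (x S) (w S) :=
  (hw.rowCount.flatMap fun _ => hx.quantifierWord.flatMap fun _ => nil.cons _).append
    (hw.scan ((hx.rename Fin.succ).rowWord φ name (hw.rename Fin.succ) (reg 0).rowCount
      (reg 0).rowPrefix))

theorem questionWord (hx : PolyTime x) : PolyTime fun S => questionWord (x S) :=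
  hx.quantifierWord.tally.cons _

end PolyTime

section Scan

variable {α : Type} {F G : List α → α → List α}

theorem scan_append (p w w' : List α) :
    scan F p (w ++ w') = scan F p w ++ scan F (w.reverse ++ p) w' := by
  induction w generalizing p with
  | nil => rfl
  | cons a w ih => simp [scan, ih]

theorem scan_append_left (s : List α) (h : ∀ p a, F (p ++ s) a = G p a) (p w : List α) :
    scan F (p ++ s) w = scan G p w := by
  induction w generalizing p with
  | nil => rfl
  | cons a w ih => rw [scan, scan, h, ← List.cons_append, ih]

theorem scan_nil (p w : List α) : scan (fun _ _ => []) p w = [] := by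
  induction w generalizing p with
  | nil => rfl
  | cons _ _ ih => exact ih _

theorem scan_ofFn {m : ℕ} (p : List α) (g : Fin m → α) :
    scan F p (List.ofFn g) = (List.finRange m).flatMap fun i : Fin m =>
      F (((List.ofFn g).take i).reverse ++ p) (g i) := by
  induction m generalizing p with
  | zero => rfl
  | succ m ih =>
    simp [List.ofFn_succ, List.finRange_succ, scan, ih, List.flatMap_map]

end Scan

section ScanAdversaries

open List (replicate)

variable {L L' : FirstOrder.Language.{0, 0}} {A : Type} {m : ℕ} {p : List (Letter L L' A)}

theorem rowCount_append (w w' : List (Letter L L' A)) :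
    rowCount (w ++ w') = rowCount w ++ rowCount w' :=
  List.flatMap_append

theorem rowPrefix_elem_cons (a : A) (p : List (Letter L L' A)) :
    rowPrefix (.adversary (.elem a) :: p) = .adversary (.elem a) :: rowPrefix p := by
  rw [rowPrefix, scan, ← List.nil_append [_],
    scan_append_left [(.adversary (.elem a) : Letter L L' A)]]
  · rfl
  · rintro q (_ | _ | _ | _ | _) <;> simp [rowCount]

theorem rowPrefix_advEnd_cons (p : List (Letter L L' A)) :
    rowPrefix (.adversary .advEnd :: p) = rowPrefix p := by
  rw [rowPrefix, scan, ← List.nil_append [_],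
    scan_append_left [(.adversary .advEnd : Letter L L' A)]]
  · rfl
  · rintro q (_ | _ | _ | _ | _) <;> simp [rowCount]

theorem rowPrefix_tupleEnd_cons (p : List (Letter L L' A)) :
    rowPrefix (.adversary .tupleEnd :: p) = [] := by
  rw [rowPrefix, scan, ← List.nil_append [_],
    scan_append_left [(.adversary .tupleEnd : Letter L L' A)], scan_nil]
  · rfl
  · rintro q (_ | _ | _ | _ | _) <;> simp [rowCount]

/-- The word of the elements `u`. -/
def elemWord (u : List A) : List (Letter L L' A) :=
  u.map fun a => .adversary (.elem a)

theorem rowPrefix_elemWord_append (u : List A) (p : List (Letter L L' A)) :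
    rowPrefix (elemWord u ++ p) = elemWord u ++ rowPrefix p := by
  induction u with
  | nil => rfl
  | cons a u ih =>
    rw [elemWord, List.map_cons, List.cons_append, rowPrefix_elem_cons, ← elemWord, ih]
    rfl

theorem rowCount_elemWord (u : List A) : rowCount (elemWord (L := L) (L' := L') u) = [] := by
  simp [rowCount, elemWord]

/-- The reverse `p` of a word of adversaries stops after `k` complete tuples, before the next
one. -/
structure AtRow (p : List (Letter L L' A)) (k : ℕ) : Prop where
  rowCount_eq : rowCount p = replicate k (.target .tick)
  rowPrefix_eq : rowPrefix p = []

theorem AtRow.nil : AtRow ([] : List (Letter L L' A)) 0 := ⟨rfl, rfl⟩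

theorem AtRow.advEnd_cons {k : ℕ} (h : AtRow p k) : AtRow (.adversary .advEnd :: p) k :=
  ⟨h.rowCount_eq, (rowPrefix_advEnd_cons p).trans h.rowPrefix_eq⟩

/-- The word of a row of an adversary. -/
def tupleWord (t : Fin m → A) : List (Letter L L' A) :=
  elemWord (List.ofFn t) ++ [.adversary .tupleEnd]

/-- The word of an adversary. -/
def adversaryWord (B : List (Fin m → A)) : List (Letter L L' A) :=
  B.flatMap tupleWord ++ [.adversary .advEnd]

theorem adversaryWord_cons (t : Fin m → A) (B : List (Fin m → A)) :
    adversaryWord (t :: B) = (tupleWord t ++ adversaryWord B : List (Letter L L' A)) := by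
  simp [adversaryWord]

theorem map_adversary_encodeAdversaries (l : List (List (Fin m → A))) :
    (encodeAdversaries l).map (.adversary : AdvSym A → Letter L L' A) =
      l.flatMap adversaryWord := by
  have htuple (t : Fin m → A) :
      ((List.ofFn t).map AdvSym.elem ++ [AdvSym.tupleEnd]).map
        (.adversary : AdvSym A → Letter L L' A) = tupleWord t := by
    simp only [tupleWord, elemWord, List.map_append, List.map_map]
    rfl
  simp only [encodeAdversaries, ← List.flatMap_def, List.map_flatMap, List.map_append, htuple]
  rfl

theorem rowCount_flatMap_adversaryWord (l : List (List (Fin m → A))) :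
    rowCount (l.flatMap adversaryWord) =
      replicate l.flatten.length (.target .tick : Letter L L' A) := by
  have htuple (t : Fin m → A) : rowCount (tupleWord t) = [(.target .tick : Letter L L' A)] := by
    rw [tupleWord, rowCount_append, rowCount_elemWord]; rfl
  have hadv (B : List (Fin m → A)) : rowCount (adversaryWord B) =
      replicate B.length (.target .tick : Letter L L' A) := by
    induction B with
    | nil => rfl
    | cons t B ih =>
      rw [adversaryWord_cons, rowCount_append, htuple, ih]
      rfl
  induction l with
  | nil => rfl
  | cons B l ih =>
    rw [List.flatMap_cons, rowCount_append, hadv, ih, List.flatten_cons, List.length_append,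
      List.replicate_append_replicate]

namespace AtRow

variable {k : ℕ}

theorem tupleWord_append (h : AtRow p k) (t : Fin m → A) :
    AtRow ((tupleWord t).reverse ++ p) (k + 1) where
  rowCount_eq := by
    have hrev : (elemWord (L := L) (L' := L') (List.ofFn t)).reverse =
        elemWord (List.ofFn t).reverse := by simp [elemWord]
    rw [tupleWord, List.reverse_append, rowCount_append, rowCount_append, hrev,
      rowCount_elemWord, h.rowCount_eq, List.append_nil]
    rfl
  rowPrefix_eq := by
    rw [tupleWord, List.reverse_append]
    exact rowPrefix_tupleEnd_cons _

theorem adversaryWord_append (h : AtRow p k) (B : List (Fin m → A)) :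
    AtRow ((adversaryWord B).reverse ++ p) (k + B.length) := by
  induction B generalizing p k with
  | nil => exact h.advEnd_cons
  | cons t B ih =>
    have := ih (h.tupleWord_append t)
    rwa [← List.append_assoc, ← List.reverse_append, ← adversaryWord_cons, add_assoc,
      add_comm 1, ← List.length_cons] at this

end AtRow

variable (G : List (Letter L L' A) → List (Letter L L' A) → Letter L L' A → List (Letter L L' A))

/-- The output, when row `j` is `t`, of a scan which depends on the number of rows, and on the
elements of the current row, which have been read. -/
def rowScan (j : ℕ) (t : Fin m → A) : List (Letter L L' A) :=
  ((List.finRange m).flatMap fun i : Fin m => G (replicate j (.target .tick))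
    (elemWord ((List.ofFn t).take i).reverse) (.adversary (.elem (t i)))) ++
  G (replicate j (.target .tick)) (elemWord (List.ofFn t).reverse) (.adversary .tupleEnd)

variable {G}

theorem scan_tupleWord {k : ℕ} (h : AtRow p k) (t : Fin m → A) :
    scan (fun p c => G (rowCount p) (rowPrefix p) c) p (tupleWord t) = rowScan G k t := by
  have hpos (u : List A) : rowCount (elemWord u ++ p) = replicate k (.target .tick) ∧
      rowPrefix (elemWord u ++ p) = elemWord u := by
    rw [rowCount_append, rowCount_elemWord, rowPrefix_elemWord_append, h.1, h.2]
    simp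
  have htake (i : ℕ) : ((List.ofFn fun j => Letter.adversary (.elem (t j))).take i).reverse =
      elemWord (L := L) (L' := L') ((List.ofFn t).take i).reverse := by
    simp only [elemWord, List.map_reverse, List.map_take, List.map_ofFn]
    rfl
  have helem : elemWord (L := L) (L' := L') (List.ofFn t) =
      List.ofFn fun j => .adversary (.elem (t j)) := by
    simp only [elemWord, List.map_ofFn]
    rfl
  have hrev : (elemWord (List.ofFn t)).reverse =
      elemWord (L := L) (L' := L') (List.ofFn t).reverse := by simp [elemWord]
  rw [tupleWord, scan_append, hrev, helem, scan_ofFn]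
  simp only [htake, hpos, scan, List.append_nil, rowScan]

variable (hG : ∀ r u, G r u (.adversary .advEnd) = [])
include hG

theorem scan_adversaryWord {k : ℕ} (h : AtRow p k) (B : List (Fin m → A)) :
    scan (fun p c => G (rowCount p) (rowPrefix p) c) p (adversaryWord B) =
      (B.zipIdx k).flatMap fun t => rowScan G t.2 t.1 := by
  induction B generalizing p k with
  | nil => simp [adversaryWord, scan, hG]
  | cons t B ih =>
    rw [adversaryWord_cons, scan_append, scan_tupleWord h, ih (h.tupleWord_append t)]
    rfl

theorem scan_flatMap_adversaryWord {k : ℕ} (h : AtRow p k) (l : List (List (Fin m → A))) :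
    scan (fun p c => G (rowCount p) (rowPrefix p) c) p (l.flatMap adversaryWord) =
      (l.flatten.zipIdx k).flatMap fun t => rowScan G t.2 t.1 := by
  induction l generalizing p k with
  | nil => rfl
  | cons B l ih =>
    rw [List.flatMap_cons, scan_append, scan_adversaryWord hG h,
      ih (h.adversaryWord_append B), List.flatten_cons, List.zipIdx_append, List.flatMap_append]

end ScanAdversaries

/-! ### The reduction -/

section Map

open scoped FirstOrder
open List (replicate)

variable {L L' : FirstOrder.Language.{0, 0}} {V W : Type} (φ : L →ᴸ L') (f : V → W)

/-- The term with renamed variables, in the language to which `φ` goes. -/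
def Tm.map : Tm L V → Tm L' W
  | .var x => .var (f x)
  | .const c => .const (φ.onFunction c)

/-- The atom with renamed variables, in the language to which `φ` goes. -/
def Atom.map : Atom L V → Atom L' W
  | .rel k r ts => .rel k (φ.onRelation r) fun i => (ts i).map φ f
  | .eq s t => .eq (s.map φ f) (t.map φ f)

section Semantics

variable {A : Type} [L.Structure A] [L'.Structure A] [φ.IsExpansionOn A]

theorem Tm.eval_map (v : W → A) (t : Tm L V) : (t.map φ f).eval v = t.eval (v ∘ f) := by
  cases t with
  | var x => rfl
  | const c => exact FirstOrder.Language.LHom.map_onFunction φ (M := A) c default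

theorem Atom.holds_map (v : W → A) (α : Atom L V) :
    (α.map φ f).Holds v ↔ α.Holds (v ∘ f) := by
  cases α with
  | rel k r ts =>
    simp only [Atom.map, Atom.Holds, Tm.eval_map]
    exact Iff.of_eq (FirstOrder.Language.LHom.map_onRelation φ (M := A) r _)
  | eq s t => simp only [Atom.map, Atom.Holds, Tm.eval_map]

end Semantics

variable {A : Type} {N M : ℕ} {e : Fin N → Fin M} {k : ℕ} (he : ∀ i, (e i : ℕ) = k + i)
include he

theorem Tm.flatMap_shiftLetter_encode (t : Tm L (Fin N)) :
    (t.encode.map .source).flatMap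
        (shiftLetter φ (replicate k (.target .tick) : List (Letter L L' A))) =
      (t.map φ e).encode.map .target := by
  cases t with
  | var i =>
    have hticks (n : ℕ) (o : List (Letter L L' A)) : (replicate n (.source .tick)).flatMap
        (shiftLetter φ o) = replicate n (.target .tick) := by
      induction n with
      | zero => rfl
      | succ n ih => rw [List.replicate_succ, List.flatMap_cons, ih]; rfl
    simp only [Tm.encode, Tm.map, List.map_cons, List.map_replicate, List.flatMap_cons, hticks, he,
      ← List.replicate_append_replicate, List.map_append]
    rfl
  | const c => rfl

theorem Atom.flatMap_shiftLetter_encode (α : Atom L (Fin N)) :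
    (α.encode.map .source).flatMap
        (shiftLetter φ (replicate k (.target .tick) : List (Letter L L' A))) =
      (α.map φ e).encode.map .target := by
  have hterm := Tm.flatMap_shiftLetter_encode (A := A) φ he
  cases α with
  | rel l r ts =>
    rw [Atom.encode, List.map_cons, List.flatMap_cons, List.map_flatten,
      ← List.flatMap_id, List.flatMap_assoc, List.flatMap_def, List.map_ofFn, List.map_ofFn,
      Atom.map, Atom.encode, List.map_cons, List.map_flatten, List.map_ofFn]
    simp only [Function.comp_def, id, hterm]
    rfl
  | eq s t =>
    rw [Atom.encode, List.map_cons, List.flatMap_cons, List.map_append, List.flatMap_append, hterm,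
      hterm, Atom.map, Atom.encode, List.map_cons, List.map_append]
    rfl

end Map

section Reduce

open scoped FirstOrder
open List (replicate)

/-- The tuples `t` and `t'` have the same entries before position `i`. -/
def AgreeBefore {A : Type} {m : ℕ} (t t' : Fin m → A) (i : Fin m) : Prop :=
  ∀ j < i, t j = t' j

variable {L L' : FirstOrder.Language.{0, 0}} {A : Type} (φ : L →ᴸ L') (name : A → L'.Constants)
  (ψ : PHSentence L) (rows : List (Fin (ψ.quants.length + 1) → A))

/-- The variable which stands for variable `i` of `ψ` in the play against row `r`. -/
def reduceVar : Fin rows.length × Fin ψ.quants.length ≃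
    Fin (replicate (rows.length * ψ.quants.length) Quantifier.ex).length :=
  finProdFinEquiv.trans (finCongr List.length_replicate.symm)

theorem reduceVar_val (r : Fin rows.length) (i : Fin ψ.quants.length) :
    (reduceVar ψ rows (r, i) : ℕ) = ψ.quants.length * r + i :=
  Nat.add_comm _ _

open scoped Classical in
/-- A universal variable takes the value prescribed by the row, and an existential variable takes
the same value in all the rows with the same beginning. -/
noncomputable def cellAtoms (r : Fin rows.length) (i : Fin ψ.quants.length) :
    List (Atom L' (Fin (replicate (rows.length * ψ.quants.length) Quantifier.ex).length)) :=
  match ψ.quants[i] with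
  | .all => [.eq (.var (reduceVar ψ rows (r, i))) (.const (name (rows[r] i.castSucc)))]
  | .ex => (List.finRange rows.length).flatMap fun r' =>
    if AgreeBefore rows[r] rows[r'] i.castSucc then
      [.eq (.var (reduceVar ψ rows (r, i))) (.var (reduceVar ψ rows (r', i)))]
    else []

/-- The conditions on the play against row `r`. -/
noncomputable def rowAtoms (r : Fin rows.length) :
    List (Atom L' (Fin (replicate (rows.length * ψ.quants.length) Quantifier.ex).length)) :=
  (List.finRange ψ.quants.length).flatMap (cellAtoms name ψ rows r) ++
    ψ.matrix.map (Atom.map φ fun i => reduceVar ψ rows (r, i))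

/-- The primitive positive sentence which states that `ψ` can be won when the universal player
plays one of `rows`. The rows are one longer than the quantifier prefix, and their last entry is
ignored, because nothing is known about adversaries of length `0`. -/
noncomputable def reduce : PPSentence L' where
  val.quants := replicate (rows.length * ψ.quants.length) .ex
  val.matrix := (List.finRange rows.length).flatMap (rowAtoms φ name ψ rows)
  property _ := List.eq_of_mem_replicate

end Reduce

section ListLemmas

variable {α β : Type}

theorem flatMap_ite_eq {l : List α} (hl : l.Nodup) {a : α} [DecidablePred (· = a)] (ha : a ∈ l)
    (f : α → List β) : (l.flatMap fun b => if b = a then f b else []) = f a := by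
  induction l with
  | nil => cases ha
  | cons b l ih =>
    rw [List.nodup_cons] at hl
    rw [List.flatMap_cons]
    rcases eq_or_ne b a with rfl | hba
    · rw [if_pos rfl, List.flatMap_eq_nil_iff.2 fun c hc => if_neg (ne_of_mem_of_not_mem hc hl.1),
        List.append_nil]
    · rw [if_neg hba, ih hl.2 ((List.mem_cons.1 ha).resolve_left hba.symm), List.nil_append]

theorem flatMap_zipIdx (l : List α) (f : α × ℕ → List β) :
    l.zipIdx.flatMap f = (List.finRange l.length).flatMap fun i : Fin l.length => f (l[i], i) := by
  rw [List.flatMap_def, List.flatMap_def, ← List.ofFn_eq_map]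
  congr 1
  refine List.ext_getElem (by simp) fun i _ _ => by simp

theorem take_ofFn_eq_take_ofFn_iff {m : ℕ} (t t' : Fin m → α) (i i' : Fin m) :
    (List.ofFn t').take i' = (List.ofFn t).take i ↔ i' = i ∧ AgreeBefore t t' i := by
  constructor
  · intro h
    obtain rfl : i' = i := by simpa [Fin.ext_iff, i.2.le, i'.2.le] using congrArg List.length h
    refine ⟨rfl, fun j hj => ?_⟩
    simpa [hj] using congrArg (·[(j : ℕ)]?) h.symm
  · rintro ⟨rfl, h⟩
    refine List.ext_getElem (by simp) fun j hj _ => ?_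
    have hji : j < i' := by simp at hj; omega
    simpa using (h ⟨j, hji.trans i'.2⟩ hji).symm

end ListLemmas

section EncodeReduce

open scoped FirstOrder
open List (replicate)

variable {L L' : FirstOrder.Language.{0, 0}} {A : Type}

theorem tally_eq_replicate (w : List (Letter L L' A)) :
    tally w = replicate w.length (.target .tick) := by
  simp [tally, List.flatMap_def, List.map_const']

theorem length_elemWord (u : List A) : (elemWord (L := L) (L' := L') u).length = u.length :=
  List.length_map _

theorem elemWord_reverse_take_inj {m : ℕ} (t t' : Fin m → A) (i i' : Fin m) :
    elemWord (L := L) (L' := L') ((List.ofFn t').take i').reverse =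
      elemWord ((List.ofFn t).take i).reverse ↔ i' = i ∧ AgreeBefore t t' i := by
  have hinj : Function.Injective fun a : A => (.adversary (.elem a) : Letter L L' A) :=
    fun a b h => by cases h; rfl
  rw [← take_ofFn_eq_take_ofFn_iff, elemWord, elemWord, (List.map_injective_iff.2 hinj).eq_iff,
    List.reverse_inj]

theorem quantifierWord_encode {N : ℕ} (α : Atom L (Fin N)) :
    quantifierWord (α.encode.map (.source : _ → Letter L L' A)) = [] := by
  have hterm (t : Tm L (Fin N)) : ∀ s ∈ t.encode, ∀ q, s ≠ .quant q := by
    cases t <;> simp [Tm.encode]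
  have hatom : ∀ s ∈ α.encode, ∀ q, s ≠ .quant q := by
    cases α with
    | rel k r ts => simpa [Atom.encode, or_imp, forall_and] using fun s i => hterm (ts i) s
    | eq s t => simpa [Atom.encode, or_imp, forall_and] using ⟨hterm s, hterm t⟩
  rw [quantifierWord, List.flatMap_map, List.flatMap_eq_nil_iff]
  intro s hs
  cases s with
  | quant q => exact absurd rfl (hatom _ hs q)
  | _ => rfl

variable (φ : L →ᴸ L') (name : A → L'.Constants) (ψ : PHSentence L)

/-- The word which the reduction reads. -/
def sentenceWord : List (Letter L L' A) :=
  ψ.encode.map .source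

theorem quantifierWord_sentenceWord :
    quantifierWord (sentenceWord ψ) =
      (ψ.quants.map fun q => .source (.quant q) : List (Letter L L' A)) := by
  have hquants (qs : List Quantifier) : quantifierWord ((qs.map Sym.quant).map
      (.source : _ → Letter L L' A)) = qs.map fun q => .source (.quant q) := by
    induction qs with
    | nil => rfl
    | cons q qs ih => exact congrArg (_ :: ·) ih
  have hmatrix (αs : List (Atom L (Fin ψ.quants.length))) :
      quantifierWord ((αs.map Atom.encode).flatten.map (.source : _ → Letter L L' A)) = [] := by
    induction αs with
    | nil => rfl
    | cons α αs ih =>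
      rw [List.map_cons, List.flatten_cons, List.map_append, quantifierWord, List.flatMap_append]
      exact (congrArg₂ (· ++ ·) (quantifierWord_encode α) ih)
  rw [sentenceWord, PHSentence.encode, List.map_append, quantifierWord, List.flatMap_append]
  exact (congrArg₂ (· ++ ·) (hquants _) (hmatrix _)).trans (List.append_nil _)

theorem length_quantifierWord_sentenceWord :
    (quantifierWord (sentenceWord ψ : List (Letter L L' A))).length = ψ.quants.length := by
  rw [quantifierWord_sentenceWord, List.length_map]

theorem rowOffset_sentenceWord (r : ℕ) :
    rowOffset (sentenceWord ψ) (replicate r (.target .tick)) =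
      (replicate (ψ.quants.length * r) (.target .tick) : List (Letter L L' A)) := by
  rw [rowOffset, tally_eq_replicate, length_quantifierWord_sentenceWord, List.flatMap_def,
    List.map_const', List.length_replicate, List.flatten_replicate_replicate, Nat.mul_comm]

variable {ψ}

theorem variableWord_eq (rows : List (Fin (ψ.quants.length + 1) → A)) (r : Fin rows.length)
    (i : Fin ψ.quants.length) {u : List (Letter L L' A)} (hu : u.length = i) :
    variableWord (sentenceWord ψ) (replicate r (.target .tick)) u =
      ((.var (reduceVar ψ rows (r, i)) : Tm L' _).encode).map .target := by
  rw [variableWord, rowOffset_sentenceWord, tally_eq_replicate, hu, List.replicate_append_replicate,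
    ← reduceVar_val, Tm.encode, List.map_cons, List.map_replicate]

theorem length_elemWord_reverse_take_ofFn {m : ℕ} (t : Fin m → A) (i : Fin m) :
    (elemWord (L := L) (L' := L') ((List.ofFn t).take i).reverse).length = i := by
  simp [length_elemWord, i.2.le]

variable (l : List (List (Fin (ψ.quants.length + 1) → A)))

theorem identificationWord_eq (r : Fin l.flatten.length) (i : Fin ψ.quants.length)
    (hi : ψ.quants[i] = .ex) :
    identificationWord (sentenceWord ψ) (l.flatMap adversaryWord) (replicate r (.target .tick))
        (elemWord ((List.ofFn l.flatten[r]).take i).reverse) =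
      (cellAtoms name ψ l.flatten r i).flatMap fun α =>
        (α.encode.map .target : List (Letter L L' A)) := by
  set u : List (Letter L L' A) := elemWord ((List.ofFn l.flatten[r]).take i).reverse
  have hulen : u.length = i := length_elemWord_reverse_take_ofFn l.flatten[r] i.castSucc
  classical
  let G (r' u' : List (Letter L L' A)) : Letter L L' A → List (Letter L L' A)
    | .adversary (.elem _) => if u' = u then .target .eq ::
        (variableWord (sentenceWord ψ) (replicate r (.target .tick)) u ++
          variableWord (sentenceWord ψ) r' u) else []
    | _ => []
  have hscan := scan_flatMap_adversaryWord (G := G) (fun _ _ => rfl) AtRow.nil l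
  rw [cellAtoms, hi, List.flatMap_assoc]
  refine hscan.trans ((flatMap_zipIdx _ _).trans (List.flatMap_congr fun r' _ => ?_))
  have hu' (i' : Fin (ψ.quants.length + 1)) :
      elemWord ((List.ofFn l.flatten[r']).take i').reverse = u ↔
        i' = i.castSucc ∧ AgreeBefore l.flatten[r] l.flatten[r'] i.castSucc :=
    elemWord_reverse_take_inj _ _ i.castSucc i'
  rw [rowScan]
  refine (List.append_nil _).trans
    ((List.flatMap_congr fun i' _ => if_congr (hu' i') rfl rfl).trans ?_)
  by_cases hagree : AgreeBefore l.flatten[r] l.flatten[r'] i.castSucc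
  · simp only [hagree, and_true, if_true]
    rw [flatMap_ite_eq (List.nodup_finRange _) (List.mem_finRange _), variableWord_eq _ r i hulen,
      variableWord_eq _ r' i hulen]
    simp only [List.flatMap_cons, List.flatMap_nil, Atom.encode, List.map_cons, List.map_append,
      List.append_nil]
  · simp only [hagree, and_false, if_false, List.flatMap_nil]
    exact List.flatMap_eq_nil_iff.2 fun _ _ => rfl

theorem cellWord_eq_flatMap (w r u : List (Letter L L' A)) (a : A) :
    cellWord name (sentenceWord ψ) w r u a =
    (List.finRange ψ.quants.length).flatMap fun j : Fin _ =>
      if (j : ℕ) = u.length then match ψ.quants[j] with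
        | .all => .target .eq :: (variableWord (sentenceWord ψ) r u ++ [.target (.const (name a))])
        | .ex => identificationWord (sentenceWord ψ) w r u
      else [] := by
  rw [cellWord, quantifierWord_sentenceWord, ← List.ofFn_getElem_eq_map, scan_ofFn]
  refine List.flatMap_congr fun j _ => ?_
  refine if_congr ?_ (by cases ψ.quants[j] <;> rfl) rfl
  simp [tally_eq_replicate, List.replicate_inj, j.2.le]

theorem cellWord_castSucc (r : Fin l.flatten.length) (i : Fin ψ.quants.length) :
    cellWord name (sentenceWord ψ) (l.flatMap adversaryWord) (replicate r (.target .tick))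
        (elemWord ((List.ofFn l.flatten[r]).take i).reverse) (l.flatten[r] i.castSucc) =
      (cellAtoms name ψ l.flatten r i).flatMap fun α =>
        (α.encode.map .target : List (Letter L L' A)) := by
  have hlen := length_elemWord_reverse_take_ofFn (L := L) (L' := L') l.flatten[r] i.castSucc
  rw [cellWord_eq_flatMap]
  rw [Fin.val_castSucc] at hlen
  simp only [hlen, Fin.val_inj]
  rw [flatMap_ite_eq (List.nodup_finRange _) (List.mem_finRange i)]
  cases hi : ψ.quants[i] with
  | all =>
    rw [cellAtoms, hi, variableWord_eq _ r i hlen]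
    simp only [List.flatMap_cons, List.flatMap_nil, Atom.encode, List.map_cons, List.map_append,
      List.append_nil]
    rfl
  | ex => exact identificationWord_eq name l r i hi

theorem cellWord_last (w r : List (Letter L L' A)) {u : List (Letter L L' A)} (a : A)
    (hu : u.length = ψ.quants.length) : cellWord name (sentenceWord ψ) w r u a = [] := by
  rw [cellWord_eq_flatMap, List.flatMap_eq_nil_iff]
  exact fun j _ => if_neg (by omega)

theorem map_encode_sentence {L : FirstOrder.Language.{0, 0}} {γ : Type} (f : Sym L → γ)
    (χ : PHSentence L) : χ.encode.map f =
      (χ.quants.map .quant).map f ++ χ.matrix.flatMap fun α => α.encode.map f := by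
  rw [PHSentence.encode, List.map_append, List.map_flatten, List.map_map,
    List.map_map, List.flatMap_def]
  rfl

theorem flatMap_shiftLetter_sentenceWord {M k : ℕ} {e : Fin ψ.quants.length → Fin M}
    (he : ∀ i, (e i : ℕ) = k + i) :
    (sentenceWord ψ).flatMap (shiftLetter φ (replicate k (.target .tick))) =
      (ψ.matrix.map (Atom.map φ e)).flatMap fun α =>
        (α.encode.map .target : List (Letter L L' A)) := by
  rw [sentenceWord, map_encode_sentence, List.flatMap_append, List.flatMap_assoc,
    List.flatMap_map (Atom.map φ e)]
  simp only [Atom.flatMap_shiftLetter_encode φ he]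
  refine (congrArg (· ++ _) (List.flatMap_eq_nil_iff.2 fun s hs => ?_)).trans (List.nil_append _)
  obtain ⟨_, hq, rfl⟩ := List.mem_map.1 hs
  obtain ⟨q, -, rfl⟩ := List.mem_map.1 hq
  rfl

theorem rowScan_rowWord (r : Fin l.flatten.length) :
    rowScan (rowWord φ name (sentenceWord ψ) (l.flatMap adversaryWord)) r l.flatten[r] =
      (rowAtoms φ name ψ l.flatten r).flatMap fun α =>
        (α.encode.map .target : List (Letter L L' A)) := by
  have hlast := length_elemWord_reverse_take_ofFn (L := L) (L' := L') l.flatten[r] (Fin.last _)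
  rw [rowScan, rowAtoms, List.flatMap_append, List.finRange_succ_last, List.flatMap_append,
    List.flatMap_singleton, List.flatMap_map, List.flatMap_assoc]
  refine congrArg₂ (· ++ ·) ((congrArg₂ (· ++ ·) (List.flatMap_congr fun i _ =>
    cellWord_castSucc name l r i) (cellWord_last name _ _ _ hlast)).trans (List.append_nil _)) ?_
  refine Eq.trans ?_ (flatMap_shiftLetter_sentenceWord φ (reduceVar_val ψ l.flatten r))
  rw [← rowOffset_sentenceWord]
  rfl

theorem reductionWord_eq_encode_reduce :
    reductionWord φ name (sentenceWord ψ) (l.flatMap adversaryWord) =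
      ((reduce φ name ψ l.flatten).encode.map .target : List (Letter L L' A)) := by
  have hquants : (rowCount (l.flatMap adversaryWord) : List (Letter L L' A)).flatMap (fun _ =>
      (quantifierWord (sentenceWord ψ) : List (Letter L L' A)).flatMap fun _ =>
        [.target (.quant .ex)]) =
        (((reduce φ name ψ l.flatten).1.quants.map .quant).map .target : List (Letter L L' A)) := by
    have hconst (w : List (Letter L L' A)) : w.flatMap (fun _ => [.target (.quant .ex)]) =
        (replicate w.length (.target (.quant .ex)) : List (Letter L L' A)) := by
      simp [List.flatMap_def, List.map_const']
    rw [rowCount_flatMap_adversaryWord, hconst, length_quantifierWord_sentenceWord,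
      List.flatMap_def, List.map_const', List.length_replicate, List.flatten_replicate_replicate,
      reduce, List.map_replicate, List.map_replicate]
  have hscan := scan_flatMap_adversaryWord (fun _ _ => rfl) AtRow.nil l
    (G := rowWord φ name (sentenceWord ψ) (l.flatMap adversaryWord))
  rw [reductionWord, hquants, hscan, flatMap_zipIdx, PPSentence.encode, map_encode_sentence, reduce,
    List.flatMap_assoc]
  exact congrArg _ (List.flatMap_congr fun r _ => rowScan_rowWord φ name l r)

end EncodeReduce

/-! ### Winning strategies -/

section Strategy

variable {A : Type}

theorem prefixHolds_iff_exists_of_forall_eq_ex : ∀ (qs : List Quantifier) (_ : ∀ q ∈ qs, q = .ex)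
    (P : (Fin qs.length → A) → Prop), PrefixHolds A qs P ↔ ∃ v, P v
  | [], _, P => by
    rw [PrefixHolds]
    exact ⟨fun h => ⟨_, h⟩, fun ⟨v, h⟩ => by rwa [Subsingleton.elim Fin.elim0 v]⟩
  | q :: qs, h, P => by
    obtain rfl : q = .ex := h q List.mem_cons_self
    simp only [PrefixHolds,
      prefixHolds_iff_exists_of_forall_eq_ex qs fun q hq => h q (List.mem_cons_of_mem _ hq)]
    exact (Fin.exists_fin_succ_pi (P := P)).symm

theorem agreeBefore_cons_succ {m : ℕ} (a b : A) (x y : Fin m → A) (i : Fin m) :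
    AgreeBefore (Fin.cons a x : Fin (m + 1) → A) (Fin.cons b y) i.succ ↔
      a = b ∧ AgreeBefore x y i := by
  simp [AgreeBefore, Fin.forall_fin_succ]

theorem agreeBefore_castSucc {m : ℕ} (t t' : Fin (m + 1) → A) (i : Fin m) :
    AgreeBefore t t' i.castSucc ↔
      AgreeBefore (fun j => t j.castSucc) (fun j => t' j.castSucc) i := by
  simp [AgreeBefore, Fin.forall_fin_succ', (Fin.le_last _).not_gt]

/-- `F` is a winning strategy of the existential player for the sentence with prefix `qs` and
matrix `P`. Its argument `x` has an entry for every variable, but an existential variable depends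
only on the entries before it, and a universal variable takes the value in `x`. -/
structure IsStrategy (qs : List Quantifier) (P : (Fin qs.length → A) → Prop)
    (F : (Fin qs.length → A) → Fin qs.length → A) : Prop where
  all_eq : ∀ x i, qs[i] = .all → F x i = x i
  ex_eq : ∀ x y i, qs[i] = .ex → AgreeBefore x y i → F x i = F y i
  wins : ∀ x, P (F x)

namespace IsStrategy

theorem nil {P : (Fin 0 → A) → Prop} (h : P Fin.elim0) : IsStrategy [] P id where
  all_eq _ i := i.elim0
  ex_eq _ _ i := i.elim0
  wins x := by rwa [show id x = Fin.elim0 from funext fun i => i.elim0]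

variable {qs : List Quantifier} {P : (Fin (qs.length + 1) → A) → Prop}

theorem all_cons {F : A → (Fin qs.length → A) → Fin qs.length → A}
    (hF : ∀ a, IsStrategy qs (fun v => P (Fin.cons a v)) (F a)) :
    IsStrategy (.all :: qs) P fun x => Fin.cons (x 0) (F (x 0) (Fin.tail x)) where
  all_eq x := Fin.cases (fun _ => rfl) fun i hi => (hF (x 0)).all_eq (Fin.tail x) i hi
  ex_eq x y := by
    refine Fin.cases (fun hi => nomatch hi) fun i hi hxy => ?_
    rw [← Fin.cons_self_tail x, ← Fin.cons_self_tail y, agreeBefore_cons_succ] at hxy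
    simp only [Fin.cons_succ, hxy.1]
    exact (hF (y 0)).ex_eq _ _ i hi hxy.2
  wins x := (hF (x 0)).wins _

theorem all_tail {F : (Fin (qs.length + 1) → A) → Fin (qs.length + 1) → A}
    (hF : IsStrategy (.all :: qs) P F) (a : A) :
    IsStrategy qs (fun v => P (Fin.cons a v)) fun y => Fin.tail (F (Fin.cons a y)) where
  all_eq y i := hF.all_eq (Fin.cons a y) i.succ
  ex_eq y y' i hi hy :=
    hF.ex_eq (Fin.cons a y) (Fin.cons a y') i.succ hi ((agreeBefore_cons_succ ..).2 ⟨rfl, hy⟩)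
  wins y := by
    have hwins := hF.wins (Fin.cons a y)
    rwa [← Fin.cons_self_tail (F _), hF.all_eq _ 0 rfl] at hwins

theorem ex_cons {a : A} {F : (Fin qs.length → A) → Fin qs.length → A}
    (hF : IsStrategy qs (fun v => P (Fin.cons a v)) F) :
    IsStrategy (.ex :: qs) P fun x => Fin.cons a (F (Fin.tail x)) where
  all_eq x := Fin.cases (fun hi => nomatch hi) fun i hi => hF.all_eq (Fin.tail x) i hi
  ex_eq x y := by
    refine Fin.cases (fun _ _ => rfl) fun i hi hxy => ?_
    rw [← Fin.cons_self_tail x, ← Fin.cons_self_tail y, agreeBefore_cons_succ] at hxy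
    exact hF.ex_eq _ _ i hi hxy.2
  wins x := hF.wins _

theorem ex_tail {F : (Fin (qs.length + 1) → A) → Fin (qs.length + 1) → A}
    (hF : IsStrategy (.ex :: qs) P F) (a : A) :
    IsStrategy qs (fun v => P (Fin.cons (F (fun _ => a) 0) v))
      fun y => Fin.tail (F (Fin.cons a y)) where
  all_eq y i := hF.all_eq (Fin.cons a y) i.succ
  ex_eq y y' i hi hy :=
    hF.ex_eq (Fin.cons a y) (Fin.cons a y') i.succ hi ((agreeBefore_cons_succ ..).2 ⟨rfl, hy⟩)
  wins y := by
    have hwins := hF.wins (Fin.cons a y)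
    rwa [← Fin.cons_self_tail (F _),
      hF.ex_eq _ (fun _ => a) 0 rfl fun j hj => absurd hj (Fin.not_lt_zero j)] at hwins

end IsStrategy

theorem prefixHolds_iff_exists_isStrategy [Nonempty A] : ∀ (qs : List Quantifier)
    (P : (Fin qs.length → A) → Prop), PrefixHolds A qs P ↔ ∃ F, IsStrategy qs P F
  | [], P =>
    ⟨fun h => ⟨id, .nil h⟩, fun ⟨F, hF⟩ => by
      rw [PrefixHolds, show Fin.elim0 = F Fin.elim0 from funext fun i => i.elim0]
      exact hF.wins _⟩
  | .all :: qs, P => by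
    simp only [PrefixHolds, prefixHolds_iff_exists_isStrategy qs]
    exact ⟨fun h => (Classical.skolem.1 h).elim fun _ hF => ⟨_, .all_cons hF⟩,
      fun ⟨_, hF⟩ a => ⟨_, hF.all_tail a⟩⟩
  | .ex :: qs, P => by
    simp only [PrefixHolds, prefixHolds_iff_exists_isStrategy qs]
    exact ⟨fun ⟨_, _, hF⟩ => ⟨_, .ex_cons hF⟩,
      fun ⟨_, hF⟩ => ⟨_, _, hF.ex_tail (Classical.arbitrary A)⟩⟩

end Strategy

section Polymorphism

variable {L : FirstOrder.Language.{0, 0}} {A : Type} [L.Structure A] {V : Type} {k : ℕ}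

theorem Tm.eval_polymorphism (f : Polymorphism L A k) (v : Fin k → V → A) (t : Tm L V) :
    t.eval (fun x => f fun s => v s x) = f fun s => t.eval (v s) := by
  cases t with
  | var x => rfl
  | const c =>
    refine (FirstOrder.Language.Hom.map_constants f c).symm.trans (congrArg f ?_)
    funext s
    exact congrArg (FirstOrder.Language.Structure.funMap (M := A) c) (Subsingleton.elim _ _)

theorem Atom.holds_polymorphism (f : Polymorphism L A k) (v : Fin k → V → A) (α : Atom L V)
    (h : ∀ s, α.Holds (v s)) : α.Holds fun x => f fun s => v s x := by
  cases α with
  | rel l R ts =>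
    simp only [Atom.Holds, Tm.eval_polymorphism]
    exact f.map_rel R (fun i s => (ts i).eval (v s)) h
  | eq s t =>
    simp only [Atom.Holds, Tm.eval_polymorphism]
    exact congrArg f (funext h)

/-- The elements `e s j a` can be chosen for all `j` independently because they come from tuples of
length `m * |A|`, with one position for each pair `(j, a)`, by projectivity. -/
theorem exists_polymorphism_forall_apply_eq [Fintype A] [DecidableEq A] [Nonempty A]
    {Ω : AdversarySeq A} (hProj : Projective Ω)
    (hGen : ∀ m, 1 ≤ m → Generates L (Ω m) Finset.univ) {m : ℕ} (hm : 1 ≤ m) :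
    ∃ (k : ℕ) (f : Polymorphism L A k) (e : Fin k → Fin m → A → A),
      (∀ s (x : Fin m → A), ∃ D ∈ Ω m, (fun j => e s j (x j)) ∈ D) ∧
      ∀ j a, f (fun s => e s j a) = a := by
  let ε := Fintype.equivFin A
  obtain ⟨k, -, f, ts, hts, hf⟩ := hGen _ (Nat.mul_pos hm (Fintype.card_pos (α := A)))
    (fun p => ε.symm (finProdFinEquiv.symm p).2) (Finset.mem_univ _)
  refine ⟨k, f, fun s j a => ts s (finProdFinEquiv (j, ε a)), fun s x => ?_, fun j a => ?_⟩
  · obtain ⟨B, hB, ht⟩ := hts s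
    obtain ⟨D, hD, hBD⟩ := hProj m hm B hB
    exact ⟨D, hD, hBD (fun j => ε (x j)) (Finset.mem_image_of_mem _ ht)⟩
  · simp [hf]

end Polymorphism

section Correctness

open scoped FirstOrder

variable {L L' : FirstOrder.Language.{0, 0}} {A : Type} {ψ : PHSentence L}
  {rows : List (Fin (ψ.quants.length + 1) → A)}

variable (ψ rows) in
/-- Assignments to the variables `reduceVar` correspond to families of plays, one for each row. -/
def playsEquiv : (Fin rows.length → Fin ψ.quants.length → A) ≃
    (Fin (List.replicate (rows.length * ψ.quants.length) Quantifier.ex).length → A) :=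
  (Equiv.curry ..).symm.trans ((reduceVar ψ rows).arrowCongr (.refl A))

theorem playsEquiv_apply_reduceVar (g : Fin rows.length → Fin ψ.quants.length → A)
    (r : Fin rows.length) (i : Fin ψ.quants.length) :
    playsEquiv ψ rows g (reduceVar ψ rows (r, i)) = g r i := by
  simp [playsEquiv]

theorem forall_cellAtoms_holds_iff [L'.Structure A] {name : A → L'.Constants}
    (hname : ∀ t ∈ rows, ∀ i, (name (t i) : A) = t i)
    (g : Fin rows.length → Fin ψ.quants.length → A) (r : Fin rows.length)
    (i : Fin ψ.quants.length) :
    (∀ α ∈ cellAtoms name ψ rows r i, α.Holds (playsEquiv ψ rows g)) ↔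
      (ψ.quants[i] = .all → g r i = rows[r] i.castSucc) ∧
      (ψ.quants[i] = .ex → ∀ r', AgreeBefore rows[r] rows[r'] i.castSucc → g r i = g r' i) := by
  cases hi : ψ.quants[i] with
  | all =>
    rw [cellAtoms, hi]
    simp only [List.mem_singleton, forall_eq, Atom.Holds, Tm.eval, playsEquiv_apply_reduceVar,
      hname rows[r] (List.getElem_mem _) i.castSucc, forall_const, reduceCtorEq,
      false_imp_iff, and_true]
  | ex =>
    rw [cellAtoms, hi]
    simp only [List.forall_mem_flatMap, List.mem_finRange, reduceCtorEq, false_imp_iff, true_and,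
      forall_const]
    refine forall_congr' fun r' => ?_
    split_ifs with hagree <;>
      simp only [hagree, List.mem_singleton, forall_eq, Atom.Holds, Tm.eval, true_imp_iff,
        playsEquiv_apply_reduceVar, List.not_mem_nil, false_imp_iff, implies_true]

variable [L.Structure A]

variable (ψ rows) in
/-- `g r` is the play of the existential player, in a winning strategy for `ψ`, when the universal
player plays the row `r`. -/
structure WinsAgainst (g : Fin rows.length → Fin ψ.quants.length → A) : Prop where
  holds : ∀ r, ∀ α ∈ ψ.matrix, α.Holds (g r)
  all_eq : ∀ r i, ψ.quants[i] = .all → g r i = rows[r] i.castSucc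
  ex_eq : ∀ r r' i, ψ.quants[i] = .ex → AgreeBefore rows[r] rows[r'] i.castSucc → g r i = g r' i

theorem IsStrategy.winsAgainst {F : (Fin ψ.quants.length → A) → Fin ψ.quants.length → A}
    (hF : IsStrategy ψ.quants (fun v => ∀ α ∈ ψ.matrix, α.Holds v) F) :
    WinsAgainst ψ rows fun r => F fun j => rows[r] j.castSucc where
  holds _ := hF.wins _
  all_eq _ i := hF.all_eq _ i
  ex_eq _ _ i hi h := hF.ex_eq _ _ i hi ((agreeBefore_castSucc ..).1 h)

theorem WinsAgainst.isStrategy {g : Fin rows.length → Fin ψ.quants.length → A}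
    (hg : WinsAgainst ψ rows g) {k : ℕ} (f : Polymorphism L A k)
    (row : Fin k → (Fin ψ.quants.length → A) → Fin rows.length)
    (hrow : ∀ x (i : Fin ψ.quants.length), f (fun s => rows[row s x] i.castSucc) = x i)
    (hagree : ∀ s x y i, AgreeBefore x y i →
      AgreeBefore rows[row s x] rows[row s y] i.castSucc) :
    IsStrategy ψ.quants (fun v => ∀ α ∈ ψ.matrix, α.Holds v) fun x i =>
      f fun s => g (row s x) i where
  all_eq x i hi := by simp only [hg.all_eq _ i hi, hrow]
  ex_eq x y i hi hxy := congrArg f (funext fun s => hg.ex_eq _ _ i hi (hagree s x y i hxy))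
  wins x α hα := α.holds_polymorphism f (fun s => g (row s x)) fun s => hg.holds _ α hα

theorem mem_qcsp_iff_exists_winsAgainst [Fintype A] [DecidableEq A] [Nonempty A]
    {Ω : AdversarySeq A} (hProj : Projective Ω)
    (hGen : ∀ m, 1 ≤ m → Generates L (Ω m) Finset.univ)
    (hrows : ∀ B ∈ Ω (ψ.quants.length + 1), ∀ t ∈ B, t ∈ rows) :
    ψ ∈ QCSP L A ↔ ∃ g, WinsAgainst ψ rows g := by
  refine (prefixHolds_iff_exists_isStrategy _ _).trans
    ⟨fun ⟨_, hF⟩ => ⟨_, hF.winsAgainst⟩, fun ⟨g, hg⟩ => ?_⟩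
  obtain ⟨k, f, e, he, hf⟩ := exists_polymorphism_forall_apply_eq hProj hGen
    (Nat.succ_pos ψ.quants.length)
  let extend (x : Fin ψ.quants.length → A) : Fin (ψ.quants.length + 1) → A :=
    Fin.snoc x (Classical.arbitrary A)
  have hmem (s : Fin k) (x) : ∃ r : Fin rows.length, rows[r] = fun j => e s j (extend x j) := by
    obtain ⟨D, hD, ht⟩ := he s (extend x)
    obtain ⟨i, hi, h⟩ := List.getElem_of_mem (hrows D hD _ ht)
    exact ⟨⟨i, hi⟩, h⟩
  choose row hrow using hmem
  refine ⟨_, hg.isStrategy f row (fun x i => ?_) fun s x y i hxy => ?_⟩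
  · simp only [hrow, hf, extend, Fin.snoc_castSucc]
  · rw [hrow, hrow, agreeBefore_castSucc]
    intro j hj
    simp only [extend, Fin.snoc_castSucc, hxy j hj]

variable [L'.Structure A] (φ : L →ᴸ L') [φ.IsExpansionOn A] {name : A → L'.Constants}

section Holds

variable (hname : ∀ t ∈ rows, ∀ i, (name (t i) : A) = t i)
  (g : Fin rows.length → Fin ψ.quants.length → A)
include hname

theorem forall_rowAtoms_holds_iff (r : Fin rows.length) :
    (∀ α ∈ rowAtoms φ name ψ rows r, α.Holds (playsEquiv ψ rows g)) ↔
      (∀ i, (ψ.quants[i] = .all → g r i = rows[r] i.castSucc) ∧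
        (ψ.quants[i] = .ex → ∀ r', AgreeBefore rows[r] rows[r'] i.castSucc → g r i = g r' i)) ∧
      ∀ α ∈ ψ.matrix, α.Holds (g r) := by
  have hplay : (playsEquiv ψ rows g ∘ fun i => reduceVar ψ rows (r, i)) = g r :=
    funext (playsEquiv_apply_reduceVar g r)
  simp only [rowAtoms, List.forall_mem_append, List.forall_mem_flatMap, List.forall_mem_map,
    List.mem_finRange, forall_const, forall_cellAtoms_holds_iff hname, Atom.holds_map, hplay]

theorem forall_reduce_holds_iff :
    (∀ α ∈ (reduce φ name ψ rows).1.matrix, α.Holds (playsEquiv ψ rows g)) ↔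
      WinsAgainst ψ rows g := by
  refine List.forall_mem_flatMap.trans ?_
  simp only [List.mem_finRange, forall_const]
  refine (forall_congr' fun r => forall_rowAtoms_holds_iff φ hname g r).trans
    ⟨fun h => ⟨fun r => (h r).2, fun r i => ((h r).1 i).1, fun r r' i hi => ((h r).1 i).2 hi r'⟩,
      fun h r => ⟨fun i => ⟨h.all_eq r i, fun hi r' => h.ex_eq r r' i hi⟩, h.holds r⟩⟩

end Holds

theorem reduce_mem_csp_iff (hname : ∀ t ∈ rows, ∀ i, (name (t i) : A) = t i) :
    reduce φ name ψ rows ∈ CSP L' A ↔ ∃ g, WinsAgainst ψ rows g :=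
  (prefixHolds_iff_exists_of_forall_eq_ex _ (reduce φ name ψ rows).2 _).trans <|
    (playsEquiv ψ rows).exists_congr_right.symm.trans <|
      exists_congr fun g => forall_reduce_holds_iff φ hname g

end Correctness

section Main

open scoped FirstOrder

theorem PHSentence.length_quants_le {L : FirstOrder.Language.{0, 0}} (ψ : PHSentence L) :
    ψ.quants.length ≤ ψ.encode.length := by
  simp [PHSentence.encode]

section Expansion

variable {L L' : FirstOrder.Language.{0, 0}} {A : Type} (φ : L →ᴸ L') (name : A → L'.Constants)

/-- The output letter which a letter of the reduction stands for, with a junk value for those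
which do not occur in its result. -/
def Letter.output : Letter L L' A → Sym L'
  | .target s => s
  | .source _ | .adversary _ => .tick

theorem map_unit_questionWord (ψ : PHSentence L) :
    (questionWord (sentenceWord ψ : List (Letter L L' A))).map (fun _ => ()) =
      List.replicate (ψ.quants.length + 1) () := by
  rw [List.map_const', questionWord, tally_eq_replicate, List.length_cons, List.length_replicate,
    length_quantifierWord_sentenceWord]

theorem map_output_reductionWord (ψ : PHSentence L)
    (l : List (List (Fin (ψ.quants.length + 1) → A))) :
    (reductionWord φ name (sentenceWord ψ)
      ((encodeAdversaries l).map .adversary)).map Letter.output =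
        (reduce φ name ψ l.flatten).encode := by
  rw [map_adversary_encodeAdversaries, reductionWord_eq_encode_reduce, List.map_map]
  exact List.map_id _

variable [Finite (Sym L)] [Finite (Sym L')]

theorem nonempty_tm2ComputableInPolyTime_reduce [Finite A]
    (enum : (m : ℕ) → List (List (Fin m → A))) (M : Turing.TM2ComputableAux Unit (AdvSym A))
    (p : Polynomial ℕ)
    (hM : ∀ m, 1 ≤ m → Nonempty (Turing.TM2OutputsInTime M.tm
      ((List.replicate m ()).map M.inputAlphabet.invFun)
      (some ((encodeAdversaries (enum m)).map M.outputAlphabet.invFun)) (p.eval m))) :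
    Nonempty (Turing.TM2ComputableInPolyTime PHSentence.encode PPSentence.encode
      fun ψ : PHSentence L => reduce φ name ψ (enum (ψ.quants.length + 1)).flatten) := by
  refine nonempty_tm2ComputableInPolyTime_of_subroutine (α := Letter L L' A)
    (pre := fun S => questionWord (S 0)) (post := fun S => reductionWord φ name (S 0) (S 1))
    M (fun _ => ()) .adversary .source Letter.output (PolyTime.reg 0).questionWord
    (PolyTime.reductionWord φ name (.reg 0) (.reg 1)) (p.comp (.X + 1)) fun ψ => ?_
  obtain ⟨h⟩ := hM (ψ.quants.length + 1) (Nat.succ_pos _)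
  refine ⟨encodeAdversaries (enum _), ?_, map_output_reductionWord φ name ψ _⟩
  have htime : p.eval (ψ.quants.length + 1) ≤ (p.comp (.X + 1)).eval ψ.encode.length := by
    simpa using eval_le_eval p (Nat.succ_le_succ ψ.length_quants_le)
  change Nonempty (Turing.TM2OutputsInTime M.tm
    (((questionWord (sentenceWord ψ)).map fun _ => ()).map _) _ _)
  rw [map_unit_questionWord]
  exact ⟨⟨h.toEvalsTo, h.steps_le_m.trans htime⟩⟩

theorem polyTimeReducible_of_expansion [Fintype A] [DecidableEq A] [Nonempty A] [L.Structure A]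
    [L'.Structure A] [φ.IsExpansionOn A] {Ω : AdversarySeq A}
    (hname : ∀ m, 1 ≤ m → ∀ B ∈ Ω m, ∀ t ∈ B, ∀ i : Fin m, (name (t i) : A) = t i)
    (hEff : Effective Ω) (hProj : Projective Ω) (hBdd : PolynomiallyBounded Ω)
    (hGen : ∀ m, 1 ≤ m → Generates L (Ω m) Finset.univ) :
    PolyTimeReducible PHSentence.encode PPSentence.encode (QCSP L A) (CSP L' A) := by
  obtain ⟨enum, p, M, hM⟩ := hEff
  obtain ⟨b, hb⟩ := hBdd
  have hmem {m : ℕ} (hm : 1 ≤ m) (t : Fin m → A) :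
      t ∈ (enum m).flatten ↔ ∃ B ∈ Ω m, t ∈ B := by
    simp [← (hM m hm).1]
  refine ⟨fun ψ => reduce φ name ψ (enum (ψ.quants.length + 1)).flatten,
    nonempty_tm2ComputableInPolyTime_reduce φ name enum M (p.comp (.X + b)) fun m hm => ?_,
    fun ψ => ?_⟩
  · obtain ⟨h⟩ := (hM m hm).2
    have htime : p.eval (m + width (Ω m)) ≤ (p.comp (.X + b)).eval m := by
      simpa using eval_le_eval p (Nat.add_le_add_left (hb m hm) m)
    exact ⟨⟨h.toEvalsTo, h.steps_le_m.trans htime⟩⟩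
  · have hm := Nat.succ_pos ψ.quants.length
    have hnamed (t) (ht : t ∈ (enum (ψ.quants.length + 1)).flatten) (i) :
        (name (t i) : A) = t i := by
      obtain ⟨B, hB, ht⟩ := (hmem hm t).1 ht
      exact hname _ hm B hB t ht i
    exact (mem_qcsp_iff_exists_winsAgainst hProj hGen fun B hB t ht =>
      (hmem hm t).2 ⟨B, hB, ht⟩).trans (reduce_mem_csp_iff φ hnamed).symm

end Expansion

theorem nonempty_of_nonDegenerate {A : Type} {Ω : Finset (Adversary A 2)} (h : NonDegenerate Ω) :
    Nonempty A := by
  by_contra hA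
  rw [not_nonempty_iff] at hA
  exact absurd (h (funext fun x => isEmptyElim (x.2.1 0))) zero_ne_one

theorem finite_sym_withConstants (L : FirstOrder.Language.{0, 0}) (C : Type)
    [Finite (Σ k, L.Relations k)] [Finite L.Constants] [Finite C] :
    Finite (Sym (L.withConstants C)) := by
  have : Finite (L.withConstants C).Constants := inferInstanceAs (Finite (L.Constants ⊕ C))
  have : Finite (Σ k, (L.withConstants C).Relations k) := by
    refine Finite.of_injective
      (fun r => r.2.elim (fun s => (⟨r.1, s⟩ : Σ k, L.Relations k)) Empty.elim) ?_
    rintro ⟨k, r | r⟩ ⟨l, s | s⟩ h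
    · cases h
      rfl
    all_goals exact Empty.elim ‹_›
  infer_instance

theorem exists_name {L L' : FirstOrder.Language.{0, 0}} {A : Type} [Fintype A] [Nonempty A]
    [L.Structure A] [L'.Structure A] {Ω : AdversarySeq A}
    (hGen : Generates L (Ω 1) Finset.univ)
    (hΩ : ∀ m, 1 ≤ m → ∀ B ∈ Ω m, ∀ t ∈ B, ∀ i : Fin m, ∃ c : L'.Constants, (c : A) = t i) :
    ∃ name : A → L'.Constants,
      ∀ m, 1 ≤ m → ∀ B ∈ Ω m, ∀ t ∈ B, ∀ i : Fin m, (name (t i) : A) = t i := by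
  obtain ⟨k, hk, -, ts, hts, -⟩ := hGen (fun _ => Classical.arbitrary A) (Finset.mem_univ _)
  obtain ⟨B, hB, ht⟩ := hts ⟨0, hk⟩
  obtain ⟨c, -⟩ := hΩ 1 le_rfl B hB _ ht 0
  have hname (a : A) : ∃ c : L'.Constants, (∃ c' : L'.Constants, (c' : A) = a) → (c : A) = a := by
    by_cases ha : ∃ c' : L'.Constants, (c' : A) = a
    · exact ha.imp fun _ h _ => h
    · exact ⟨c, fun h => absurd h ha⟩
  choose name hname using hname
  exact ⟨name, fun m hm B hB t ht i => hname _ (hΩ m hm B hB t ht i)⟩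

end Main

end QCSPReduction

theorem mainTheorem8 (L : FirstOrder.Language.{0, 0})
    [∀ k, IsEmpty (L.Functions (k + 1))]
    [Finite (Σ k, L.Relations k)] [Finite L.Constants]
    (A : Type) [Fintype A] [DecidableEq A] [L.Structure A]
    (Ω : QCSPReduction.AdversarySeq A)
    (hNonDeg : ∀ m, 1 ≤ m → QCSPReduction.NonDegenerate (Ω m))
    (hEff : QCSPReduction.Effective Ω)
    (hProj : QCSPReduction.Projective Ω)
    (hBdd : QCSPReduction.PolynomiallyBounded Ω)
    (hGen : ∀ m, 1 ≤ m → QCSPReduction.Generates L (Ω m) Finset.univ) :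
    (∀ (C : Type) [Finite C] (ι : C → A),
      letI : (FirstOrder.Language.constantsOn C).Structure A :=
        FirstOrder.Language.constantsOn.structure ι
      (∀ m, 1 ≤ m → ∀ B ∈ Ω m, ∀ t ∈ B, ∀ i : Fin m,
        ∃ c : (L.withConstants C).Constants, (c : A) = t i) →
      QCSPReduction.PolyTimeReducible
        QCSPReduction.PHSentence.encode QCSPReduction.PPSentence.encode
        (QCSPReduction.QCSP L A) (QCSPReduction.CSP (L.withConstants C) A)) ∧
    ((∀ a : A, ∃ c : L.Constants, (c : A) = a) →
      QCSPReduction.PolyTimeReducible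
        QCSPReduction.PHSentence.encode QCSPReduction.PPSentence.encode
        (QCSPReduction.QCSP L A) (QCSPReduction.CSP L A)) := by
  have : Nonempty A := QCSPReduction.nonempty_of_nonDegenerate (hNonDeg 2 one_le_two)
  refine ⟨fun C _ ι => ?_, fun hC => ?_⟩
  · let _ : (FirstOrder.Language.constantsOn C).Structure A :=
      FirstOrder.Language.constantsOn.structure ι
    intro hC
    have := QCSPReduction.finite_sym_withConstants L C
    obtain ⟨name, hname⟩ := QCSPReduction.exists_name (hGen 1 le_rfl) hC
    exact QCSPReduction.polyTimeReducible_of_expansion (L.lhomWithConstants C) name hname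
      hEff hProj hBdd hGen
  · choose name hname using hC
    exact QCSPReduction.polyTimeReducible_of_expansion (FirstOrder.Language.LHom.id L) name
      (fun _ _ _ _ t _ i => hname (t i)) hEff hProj hBdd hGen
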